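/- Let $c_0\in(0,1)$, $c_1>0$, $H^1_R(0,1)=\{\phi\in H^1(0,1):\phi(1)=0\}$ and $\mathbb H_0=H^1_R(0,1)\times L^2(0,1)$, $\mathbb H=H^1(0,1)\times L^2(0,1)$. All solutions below are weak (finite energy) solutions: continuous functions of $t\ge 0$ with values in the state space, where $y_t$ is the time derivative of $y$ in $L^2(0,1)$, and the wave equations and the boundary conditions on $y_x$ hold in the weak sense (tested with functions in $H^1(0,1)$ and integrated in time). A boundary flux $y_x(1,\cdot)$ is the locally integrable function $g$ on $[0,\infty)$, unique almost everywhere, such that for all $\phi\in H^1(0,1)$ with $\phi(0)=0$ and all $t\ge0$ $$\langle y_t(t),\phi\rangle_{L^2}-\langle y_t(0),\phi\rangle_{L^2}=-\int_0^t\langle y_x(s),\phi'\rangle_{L^2}\,ds+\phi(1)\int_0^t g(s)\,ds .$$ (1) For every $(\tilde z_0,\tilde z_1)\in\mathbb H_0$ the system $$\tilde z_{tt}=\tilde z_{xx},\qquad \tilde z_x(0,t)=\tfrac{c_1}{1-c_0}\tilde z(0,t)+\tfrac{c_0}{1-c_0}\tilde z_t(0,t),\qquad \tilde z(1,t)=0,$$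 has a unique solution $(\tilde z,\tilde z_t)\in C([0,\infty);\mathbb H_0)$ with initial state $(\tilde z_0,\tilde z_1)$. Its boundary flux $\tilde z_x(1,\cdot)$ exists and lies in $L^2(0,\infty)$. (2) The solution depends continuously on the initial state: there is $C$, depending only on $c_0,c_1$, with $\|(\tilde z,\tilde z_t)(t)\|_{\mathbb H_0}\le C\|(\tilde z_0,\tilde z_1)\|_{\mathbb H_0}$ for all $t\ge0$ and all initial states. (3) Let $q\in\mathbb R$, let $f:\mathbb H\to\mathbb R$ be continuous, let $d,u$ be locally integrable on $[0,\infty)$, and let $(w,w_t)\in C([0,\infty);\mathbb H)$ be a solution of the plant $$w_{tt}=w_{xx},\qquad w_x(0,t)=-q\,w(0,t),\qquad w_x(1,t)=u(t)+F(t),\qquad F(t)=f(w(\cdot,t),w_t(\cdot,t))+d(t),$$ where $F$ is the total disturbance. Let $(v,v_t),(z,z_t)\in C([0,\infty);\mathbb H)$ and $W\in C([0,\infty);H^1(0,1))$ be a solution of the disturbance estimator $$v_{tt}=v_{xx},\quad v_x(0,t)=-q\,w(0,t)+c_1[v(0,t)-w(0,t)],\quad v_x(1,t)=u(t)-W_x(1,t),$$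 $$W_t=-W_x,\quad W(0,t)=-c_0[v(0,t)-w(0,t)],$$ $$z_{tt}=z_{xx},\quad z_x(0,t)=\tfrac{c_1}{1-c_0}z(0,t)+\tfrac{c_0}{1-c_0}z_t(0,t),\quad z(1,t)=v(1,t)+W(1,t)-w(1,t).$$ Then the boundary flux $z_x(1,\cdot)$ exists, and $-z_x(1,\cdot)$ is an estimate of $F$ with error in $L^2$: $F-(-z_x(1,\cdot))\in L^2(0,\infty)$. -/

import Mathlib

open MeasureTheory Set
open scoped RealInnerProductSpace

namespace WaveEstimator

/-- The real Hilbert space `L²(0,1)`. -/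
abbrev L2 : Type := Lp ℝ 2 (volume.restrict (Ioo (0 : ℝ) 1))

lemma L2.intervalIntegrable (g : L2) {x : ℝ} (hx : x ∈ Icc (0 : ℝ) 1) :
    IntervalIntegrable g volume 0 x := by
  rw [intervalIntegrable_iff_integrableOn_Ioo_of_le hx.1]
  have h : Integrable g (volume.restrict (Ioo (0 : ℝ) 1)) :=
    (Lp.memLp g).integrable (by norm_num)
  exact IntegrableOn.mono_set h (Ioo_subset_Ioo_right hx.2)

/-- `IsPrimitive g a y`: the class `y` is represented by `x ↦ a + ∫₀ˣ g`. -/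
def IsPrimitive (g : L2) (a : ℝ) (y : L2) : Prop :=
  ∀ᵐ x ∂(volume.restrict (Ioo (0 : ℝ) 1)), y x = a + ∫ s in (0 : ℝ)..x, g s

lemma IsPrimitive.add {g g' y y' : L2} {a a' : ℝ} (h : IsPrimitive g a y)
    (h' : IsPrimitive g' a' y') : IsPrimitive (g + g') (a + a') (y + y') := by
  have hg : ∀ᵐ s ∂volume, s ∈ Ioo (0 : ℝ) 1 → (g + g' : L2) s = g s + g' s :=
    (ae_restrict_iff' measurableSet_Ioo).1 (Lp.coeFn_add g g')
  filter_upwards [h, h', Lp.coeFn_add y y', ae_restrict_mem measurableSet_Ioo]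
    with x hx hx' hy hm
  have e : ∫ s in (0 : ℝ)..x, (g + g' : L2) s = ∫ s in (0 : ℝ)..x, (g s + g' s) := by
    refine intervalIntegral.integral_congr_ae ?_
    filter_upwards [hg] with s hs hs'
    rw [uIoc_of_le hm.1.le] at hs'
    exact hs ⟨hs'.1, hs'.2.trans_lt hm.2⟩
  rw [hy, Pi.add_apply, hx, hx', e, intervalIntegral.integral_add
    (g.intervalIntegrable ⟨hm.1.le, hm.2.le⟩) (g'.intervalIntegrable ⟨hm.1.le, hm.2.le⟩)]
  ring

lemma IsPrimitive.smul {g y : L2} {a : ℝ} (c : ℝ) (h : IsPrimitive g a y) :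
    IsPrimitive (c • g) (c * a) (c • y) := by
  have hg : ∀ᵐ s ∂volume, s ∈ Ioo (0 : ℝ) 1 → (c • g : L2) s = c * g s :=
    (ae_restrict_iff' measurableSet_Ioo).1 (Lp.coeFn_smul c g)
  filter_upwards [h, Lp.coeFn_smul c y, ae_restrict_mem measurableSet_Ioo] with x hx hy hm
  have e : ∫ s in (0 : ℝ)..x, (c • g : L2) s = ∫ s in (0 : ℝ)..x, c * g s := by
    refine intervalIntegral.integral_congr_ae ?_
    filter_upwards [hg] with s hs hs'
    rw [uIoc_of_le hm.1.le] at hs'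
    exact hs ⟨hs'.1, hs'.2.trans_lt hm.2⟩
  rw [hy, Pi.smul_apply, hx, e, intervalIntegral.integral_const_mul, smul_eq_mul]
  ring

lemma isPrimitive_zero : IsPrimitive 0 0 0 := by
  have hg : ∀ᵐ s ∂volume, s ∈ Ioo (0 : ℝ) 1 → (0 : L2) s = 0 :=
    (ae_restrict_iff' measurableSet_Ioo).1 (Lp.coeFn_zero ℝ 2 _)
  filter_upwards [Lp.coeFn_zero ℝ 2 (volume.restrict (Ioo (0 : ℝ) 1)),
    ae_restrict_mem measurableSet_Ioo] with x hy hm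
  have e : ∫ s in (0 : ℝ)..x, (0 : L2) s = ∫ s in (0 : ℝ)..x, (0 : ℝ) := by
    refine intervalIntegral.integral_congr_ae ?_
    filter_upwards [hg] with s hs hs'
    rw [uIoc_of_le hm.1.le] at hs'
    exact hs ⟨hs'.1, hs'.2.trans_lt hm.2⟩
  rw [hy, e]
  simp

lemma IsPrimitive.unique {g y : L2} {a b : ℝ} (h : IsPrimitive g a y)
    (h' : IsPrimitive g b y) : a = b := by
  have hne : (ae (volume.restrict (Ioo (0 : ℝ) 1))).NeBot := by
    rw [ae_neBot, Ne, Measure.restrict_eq_zero]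
    simp
  obtain ⟨x, hx, hx'⟩ := (h.and h').exists
  linarith

/-- The Sobolev space `H¹(0,1)`: the pairs `(y, y')` in `L²(0,1) × L²(0,1)` such that `y` has an
absolutely continuous representative with derivative `y'`; its norm is
`(‖y‖² + ‖y'‖²)^{1/2}`. -/
def h1Submodule : Submodule ℝ (WithLp 2 (L2 × L2)) where
  carrier := {p | ∃ a : ℝ, IsPrimitive p.snd a p.fst}
  zero_mem' := ⟨0, isPrimitive_zero⟩
  add_mem' := fun ⟨a, ha⟩ ⟨b, hb⟩ => ⟨a + b, ha.add hb⟩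
  smul_mem' := fun c _ ⟨a, ha⟩ => ⟨c * a, ha.smul c⟩

/-- `H¹(0,1)` as a type, with the inner product of `L²(0,1) × L²(0,1)`. -/
abbrev H1 : Type := h1Submodule

/-- The underlying `L²` function. -/
def H1.fn (y : H1) : L2 := y.1.fst

/-- The (weak) spatial derivative. -/
def H1.dx (y : H1) : L2 := y.1.snd

/-- The boundary value `y(0)`. -/
noncomputable def H1.left (y : H1) : ℝ := Classical.choose y.2

/-- The boundary value `y(1)`. -/
noncomputable def H1.right (y : H1) : ℝ := y.left + ∫ s in (0 : ℝ)..1, y.dx s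

lemma H1.left_spec (y : H1) : IsPrimitive y.dx y.left y.fn := Classical.choose_spec y.2

lemma H1.left_add (y y' : H1) : (y + y').left = y.left + y'.left :=
  (y + y').left_spec.unique (y.left_spec.add y'.left_spec)

lemma H1.left_smul (c : ℝ) (y : H1) : (c • y).left = c * y.left :=
  (c • y).left_spec.unique (y.left_spec.smul c)

lemma integral_L2 (g : L2) :
    ∫ s in (0 : ℝ)..1, g s = ∫ s, g s ∂(volume.restrict (Ioo (0 : ℝ) 1)) := by
  rw [intervalIntegral.integral_of_le zero_le_one, integral_Ioc_eq_integral_Ioo]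

lemma L2.integrable (g : L2) : Integrable g (volume.restrict (Ioo (0 : ℝ) 1)) :=
  (Lp.memLp g).integrable (by norm_num)

lemma H1.right_add (y y' : H1) : (y + y').right = y.right + y'.right := by
  have e : ∫ s, (y.dx + y'.dx : L2) s ∂(volume.restrict (Ioo (0 : ℝ) 1))
      = ∫ s, (y.dx s + y'.dx s) ∂(volume.restrict (Ioo (0 : ℝ) 1)) :=
    integral_congr_ae (Lp.coeFn_add _ _)
  have hd : (y + y').dx = y.dx + y'.dx := rfl
  simp only [H1.right, integral_L2, H1.left_add, hd]
  rw [e, integral_add y.dx.integrable y'.dx.integrable]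
  ring

lemma H1.right_smul (c : ℝ) (y : H1) : (c • y).right = c * y.right := by
  have e : ∫ s, (c • y.dx : L2) s ∂(volume.restrict (Ioo (0 : ℝ) 1))
      = ∫ s, c * y.dx s ∂(volume.restrict (Ioo (0 : ℝ) 1)) :=
    integral_congr_ae (Lp.coeFn_smul _ _)
  have hd : (c • y).dx = c • y.dx := rfl
  simp only [H1.right, integral_L2, H1.left_smul, hd]
  rw [e, integral_const_mul]
  ring

/-- `H¹_R(0,1) = {φ ∈ H¹(0,1) : φ(1) = 0}`. -/
def H1R : Submodule ℝ H1 where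
  carrier := {y | y.right = 0}
  zero_mem' := by
    have h := H1.right_smul 0 0
    simpa using h
  add_mem' := fun {a b} ha hb => by
    simp only [mem_ofPred_eq] at ha hb ⊢
    rw [H1.right_add, ha, hb, add_zero]
  smul_mem' := fun c y hy => by
    simp only [mem_ofPred_eq] at hy ⊢
    rw [H1.right_smul, hy, mul_zero]

/-- The state space `H¹(0,1) × L²(0,1)`; a state is `(y, y_t)`. -/
abbrev State : Type := WithLp 2 (H1 × L2)

/-- The state space `H¹_R(0,1) × L²(0,1)`. -/
abbrev State0 : Type := WithLp 2 (H1R × L2)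

/-- The inclusion of `H¹_R(0,1) × L²(0,1)` into `H¹(0,1) × L²(0,1)`. -/
def State0.toState (x : State0) : State := WithLp.toLp 2 ((x.fst : H1), x.snd)

/-- The displacement `y(·,t)` of a state `(y, y_t)`. -/
def State.pos (x : State) : H1 := x.fst

/-- The velocity `y_t(·,t)` of a state `(y, y_t)`. -/
def State.vel (x : State) : L2 := x.snd

/-- A finite energy trajectory: `(y, y_t) ∈ C([0,∞); H¹ × L²)`, where the second component is the
time derivative of the first one in `L²(0,1)`. -/
structure IsTrajectory (x : ℝ → State) : Prop where
  cont : ContinuousOn x (Ici 0)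
  deriv : ∀ t, 0 ≤ t → HasDerivWithinAt (fun s => (x s).pos.fn) (x t).vel (Ici 0) t

/-- Weak form, integrated in time, of `y_tt = y_xx` on `(0,1) × (0,∞)` together with
`∫₀ᵗ y_x(0,s) ds = P t`. Multiply `y_tt = y_xx` by `φ ∈ H¹(0,1)` with `φ(1) = 0`, and
integrate by parts over `(0,1) × (0,t)`. -/
def WaveLeft (x : ℝ → State) (P : ℝ → ℝ) : Prop :=
  ∀ φ : H1, φ.right = 0 → ∀ t, 0 ≤ t →
    ⟪(x t).vel, φ.fn⟫ - ⟪(x 0).vel, φ.fn⟫ =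
      -(∫ s in (0 : ℝ)..t, ⟪(x s).pos.dx, φ.dx⟫) - P t * φ.left

/-- Weak form, integrated in time, of `y_tt = y_xx` on `(0,1) × (0,∞)` together with
`∫₀ᵗ y_x(1,s) ds = Q t`: the same with test functions `φ ∈ H¹(0,1)`, `φ(0) = 0`. -/
def WaveRight (x : ℝ → State) (Q : ℝ → ℝ) : Prop :=
  ∀ φ : H1, φ.left = 0 → ∀ t, 0 ≤ t →
    ⟪(x t).vel, φ.fn⟫ - ⟪(x 0).vel, φ.fn⟫ =
      -(∫ s in (0 : ℝ)..t, ⟪(x s).pos.dx, φ.dx⟫) + Q t * φ.right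

/-- The trajectory `x = (y, y_t)` solves `y_tt = y_xx` weakly and has the boundary flux
`y_x(1,·) = g`. This determines `g` almost everywhere on `(0,∞)`. -/
def HasRightFlux (x : ℝ → State) (g : ℝ → ℝ) : Prop :=
  LocallyIntegrableOn g (Ici 0) ∧ WaveRight x (fun t => ∫ s in (0 : ℝ)..t, g s)

/-- `y_tt = y_xx` and `y_x(0,t) = c₁/(1-c₀) y(0,t) + c₀/(1-c₀) y_t(0,t)` in the weak sense; in the
time integral of the boundary condition, `∫₀ᵗ y_t(0,s) ds` is `y(0,t) - y(0,0)`. -/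
def WaveDampedLeft (c0 c1 : ℝ) (x : ℝ → State) : Prop :=
  WaveLeft x (fun t => c1 / (1 - c0) * (∫ s in (0 : ℝ)..t, (x s).pos.left)
    + c0 / (1 - c0) * ((x t).pos.left - (x 0).pos.left))

/-- `x = (z̃, z̃_t) ∈ C([0,∞); H¹_R × L²)` is a (weak, equivalently mild) solution of
`z̃_tt = z̃_xx`, `z̃_x(0,t) = c₁/(1-c₀) z̃(0,t) + c₀/(1-c₀) z̃_t(0,t)`, `z̃(1,t) = 0`,
with initial state `x0`. -/
structure IsErrorSolution (c0 c1 : ℝ) (x0 : State0) (x : ℝ → State0) : Prop where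
  cont : ContinuousOn x (Ici 0)
  init : x 0 = x0
  traj : IsTrajectory (fun t => (x t).toState)
  wave : WaveDampedLeft c0 c1 (fun t => (x t).toState)

/-- The total disturbance `F(t) = f(w(·,t), w_t(·,t)) + d(t)`. -/
def totalDisturbance (f : State → ℝ) (d : ℝ → ℝ) (w : ℝ → State) (t : ℝ) : ℝ := f (w t) + d t

/-- The plant `w_tt = w_xx`, `w_x(0,t) = -q w(0,t)`, `w_x(1,t) = u(t) + F(t)`. -/
structure IsPlantSolution (q : ℝ) (f : State → ℝ) (d u : ℝ → ℝ) (w : ℝ → State) : Prop where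
  traj : IsTrajectory w
  left : WaveLeft w (fun t => ∫ s in (0 : ℝ)..t, -q * (w s).pos.left)
  right : HasRightFlux w (fun t => u t + totalDisturbance f d w t)

/-- The disturbance estimator driven by `u` and by `w(0,·)`, `w(1,·)`:
`v_tt = v_xx`, `v_x(0,t) = -q w(0,t) + c₁ [v(0,t) - w(0,t)]`, `v_x(1,t) = u(t) - W_x(1,t)`;
`W_t = -W_x`, `W(0,t) = -c₀ [v(0,t) - w(0,t)]`;
`z_tt = z_xx`, `z_x(0,t) = c₁/(1-c₀) z(0,t) + c₀/(1-c₀) z_t(0,t)`,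
`z(1,t) = v(1,t) + W(1,t) - w(1,t)`. -/
structure IsEstimatorSolution (q c0 c1 : ℝ) (u : ℝ → ℝ) (w v : ℝ → State) (W : ℝ → H1)
    (z : ℝ → State) : Prop where
  v_traj : IsTrajectory v
  v_left : WaveLeft v (fun t => ∫ s in (0 : ℝ)..t,
    (-q * (w s).pos.left + c1 * ((v s).pos.left - (w s).pos.left)))
  /-- `r = W_x(1,·)` is the boundary flux of `(W, W_t) = (W, -W_x)`. -/
  v_right : ∃ r : ℝ → ℝ, HasRightFlux (fun t => WithLp.toLp 2 (W t, -(W t).dx)) r ∧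
    HasRightFlux v (fun t => u t - r t)
  W_cont : ContinuousOn W (Ici 0)
  W_transport : ∀ t, 0 ≤ t → HasDerivWithinAt (fun s => (W s).fn) (-(W t).dx) (Ici 0) t
  W_left : ∀ t, 0 ≤ t → (W t).left = -c0 * ((v t).pos.left - (w t).pos.left)
  z_traj : IsTrajectory z
  z_left : WaveDampedLeft c0 c1 z
  z_right : ∀ t, 0 ≤ t → (z t).pos.right = (v t).pos.right + (W t).right - (w t).pos.right

end WaveEstimator

/-!
# Disturbance estimation for the one-dimensional wave equation

The proof works with Riemann invariants. Put `X = 1 - c₀` and let `(y, y_t)` be a finite energy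
trajectory of the wave equation with the damped boundary condition at `0` and `y(1,t) = 0`.

*Reduction to one function of time.* The weak formulation says that `∫₀ᵗ y_x(s) ds` is the primitive
of `y_t(t) - y_t(0)` whose value at `0` is the integrated flux (`waveLeft_iff`, `waveRight_iff`).
So `y` and its conjugate `θ = ∫₀ᵗ y_x(0,s) ds + ∫₀ˣ y_t` form a pair with `y_t = θ_x`,
`θ_t = y_x`, to which d'Alembert's formula applies (`dAlembert`). Consequently there is a locally
square integrable `A` with `y_t + y_x = A(t + x)` and, by reflection at `x = 1`,
`y_x - y_t = A(t + 2 - x)` (`DampedTrajectory.exists_delaySolution`). In terms of `A` and of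
`η(t) = y(0,t)` the boundary condition at `0` is the neutral delay equation
`η' = X A - c₁ η`, `A(t + 2) = A(t) - 2 η'(t)`, together with `η(t) = -½ ∫ₜᵗ⁺² A`, and the flux
`y_x(1,t)` is `A(t + 1)` (`hasRightFlux_of_invariant`).

*Stability.* The energy `∫ₜᵗ⁺² A² + (2c₁/X) η²` decreases at the rate `(4c₀/X) η'²`
(`DelaySolution.energy`). This bounds the trajectory by its initial state, hence gives uniqueness,
and shows `η' ∈ L²(0,∞)`. Integrating `X A = η' + c₁ η` over `(t, t + 2)` and using
`η(t) = -½ ∫ₜᵗ⁺² A` bounds `η(t)²` by a multiple of `∫ₜᵗ⁺² η'²` (`DelaySolution.sq_le`), so `η` and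
`A` are in `L²(0,∞)` as well (`DelaySolution.memLp`).

*Existence.* The delay equation is solved in steps of length `2`, and the trajectory is read off
from `A` (`dampedTrajectory_of_invariant`, `exists_isErrorSolution`).

*The estimator.* The pair `(W, -W_x)` is itself a trajectory of the wave equation. The sum
`e = v + W - w` satisfies the damped boundary condition at `0` and has flux `-F` at `1`, while
`z = e` at `x = 1`. Therefore `z - e` is a damped trajectory, and its flux `z_x(1,·) + F`
is in `L²(0,∞)` (`estimator_flux`).
-/

namespace WaveEstimator

/-! ### Primitives of integrable functions -/

lemma ae_eq_of_integral_eq {f g : ℝ → ℝ} {a b : ℝ} (hab : a ≤ b)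
    (hf : IntervalIntegrable f volume a b) (hg : IntervalIntegrable g volume a b)
    (h : ∀ x ∈ Icc a b, ∫ s in a..x, f s = ∫ s in a..x, g s) :
    ∀ᵐ x, x ∈ Ioo a b → f x = g x := by
  filter_upwards [hf.ae_hasDerivAt_integral, hg.ae_hasDerivAt_integral] with x h1 h2 hx
  have hx' : x ∈ uIcc a b := by rw [uIcc_of_le hab]; exact Ioo_subset_Icc_self hx
  have d1 := h1 hx' a left_mem_uIcc
  have d2 := h2 hx' a left_mem_uIcc
  refine d1.unique (d2.congr_of_eventuallyEq ?_)
  filter_upwards [Icc_mem_nhds hx.1 hx.2] with y hy using h y hy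

/-- Integration by parts for primitives of integrable functions. -/
lemma integral_mul_add_mul_primitive {F G f g : ℝ → ℝ} {a b : ℝ} (hab : a ≤ b)
    (hF : IntervalIntegrable F volume a b) (hG : IntervalIntegrable G volume a b)
    (hf : ∀ x ∈ Icc a b, f x = f a + ∫ s in a..x, F s)
    (hg : ∀ x ∈ Icc a b, g x = g a + ∫ s in a..x, G s) :
    ∫ x in a..b, (F x * g x + f x * G x) = f b * g b - f a * g a := by
  have hmem : ∀ x ∈ Ioc a b, x ∈ uIcc a b := fun x hx => by
    rw [uIcc_of_le hab]; exact Ioc_subset_Icc_self hx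
  have acF := (hF.absolutelyContinuousOnInterval_intervalIntegral (c := a) left_mem_uIcc)
  have acG := (hG.absolutelyContinuousOnInterval_intervalIntegral (c := a) left_mem_uIcc)
  have acc : ∀ c : ℝ, AbsolutelyContinuousOnInterval (fun _ : ℝ => c) a b := fun c =>
    (LipschitzWith.const c).lipschitzOnWith.absolutelyContinuousOnInterval
  have key := ((acc (f a)).add acF).integral_deriv_mul_eq_sub ((acc (g a)).add acG)
  have e1 : ∀ᵐ x, x ∈ uIcc a b →
      deriv ((fun _ : ℝ => f a) + fun x => ∫ s in a..x, F s) x = F x := by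
    filter_upwards [hF.ae_hasDerivAt_integral] with x hx hm
    exact ((hx hm a left_mem_uIcc).const_add (f a)).deriv
  have e2 : ∀ᵐ x, x ∈ uIcc a b →
      deriv ((fun _ : ℝ => g a) + fun x => ∫ s in a..x, G s) x = G x := by
    filter_upwards [hG.ae_hasDerivAt_integral] with x hx hm
    exact ((hx hm a left_mem_uIcc).const_add (g a)).deriv
  have hb : b ∈ Icc a b := right_mem_Icc.2 hab
  simp only [Pi.add_apply, intervalIntegral.integral_same, add_zero, ← hf b hb, ← hg b hb] at key
  rw [← key]
  refine intervalIntegral.integral_congr_ae ?_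
  filter_upwards [e1, e2] with x h1 h2 hx
  rw [uIoc_of_le hab] at hx
  have hx2 := hmem x hx
  rw [h1 hx2, h2 hx2, hf x (Ioc_subset_Icc_self hx), hg x (Ioc_subset_Icc_self hx)]

lemma continuousOn_primitive {F f : ℝ → ℝ} {a b : ℝ} (hab : a ≤ b)
    (hF : IntervalIntegrable F volume a b)
    (hf : ∀ x ∈ Icc a b, f x = f a + ∫ s in a..x, F s) : ContinuousOn f (Icc a b) := by
  have h := (hF.absolutelyContinuousOnInterval_intervalIntegral (c := a) left_mem_uIcc).continuousOn
  rw [uIcc_of_le hab] at h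
  exact (continuousOn_const.add h).congr hf

/-! ### The functionals `g ↦ ∫₀ˣ g` on `L²(0,1)` -/

/-- The functional `g ↦ ∫₀ˣ g` on `L²(0,1)`; for `x > 1` the integral stops at `1`, and for
`x < 0` it is zero. An element of `L²(0,1)` is determined by these numbers for `0 ≤ x ≤ 1`. -/
noncomputable def L2.prim (x : ℝ) : L2 →L[ℝ] ℝ :=
  innerSL ℝ (indicatorConstLp 2 (measurableSet_Ioc (a := (0 : ℝ)) (b := x))
    (measure_ne_top (volume.restrict (Ioo (0 : ℝ) 1)) _) (1 : ℝ))

lemma L2.prim_apply {x : ℝ} (hx : x ∈ Icc (0 : ℝ) 1) (g : L2) :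
    L2.prim x g = ∫ s in (0 : ℝ)..x, g s := by
  rw [L2.prim, innerSL_apply_apply, L2.inner_indicatorConstLp_one,
    Measure.restrict_restrict measurableSet_Ioc, intervalIntegral.integral_of_le hx.1]
  refine setIntegral_congr_set ?_
  have h : Ioc 0 x ∩ Ioo (0 : ℝ) 1 = Ioc 0 x ∩ Iio 1 := by
    ext s; simp only [mem_inter_iff, mem_Ioc, mem_Ioo, mem_Iio]; grind
  have h2 : Iio (1 : ℝ) =ᵐ[volume] Iic (1 : ℝ) := Iio_ae_eq_Iic
  rw [h]
  have h3 : Ioc 0 x ∩ Iic 1 = Ioc 0 x := by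
    ext s; simp only [mem_inter_iff, mem_Ioc, mem_Iic]; grind
  conv_rhs => rw [← h3]
  exact (ae_eq_refl _).inter h2

lemma L2.prim_congr {x : ℝ} (hx : x ∈ Icc (0 : ℝ) 1) {g : L2} {f : ℝ → ℝ}
    (h : ∀ᵐ s ∂(volume.restrict (Ioo (0 : ℝ) 1)), g s = f s) :
    L2.prim x g = ∫ s in (0 : ℝ)..x, f s := by
  rw [L2.prim_apply hx]
  refine intervalIntegral.integral_congr_ae ?_
  have h1 : ∀ᵐ s : ℝ, s ≠ 1 := by simp [ae_iff, measure_singleton]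
  filter_upwards [(ae_restrict_iff' measurableSet_Ioo).1 h, h1] with s hs h1 hm
  rw [uIoc_of_le hx.1] at hm
  exact hs ⟨hm.1, lt_of_le_of_ne (hm.2.trans hx.2) h1⟩

lemma L2.ext_of_prim {g h : L2} (e : ∀ x ∈ Icc (0 : ℝ) 1, L2.prim x g = L2.prim x h) : g = h := by
  refine Lp.ext ((ae_restrict_iff' measurableSet_Ioo).2 ?_)
  have h1 : (1 : ℝ) ∈ Icc (0 : ℝ) 1 := by simp
  refine ae_eq_of_integral_eq zero_le_one (g.intervalIntegrable h1) (h.intervalIntegrable h1) ?_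
  intro x hx
  rw [← L2.prim_apply hx, ← L2.prim_apply hx, e x hx]

lemma L2.continuous_prim : Continuous (fun q : ℝ × L2 => L2.prim q.1 q.2) := by
  have h : Continuous (fun x : ℝ => indicatorConstLp (E := ℝ) 2
      (measurableSet_Ioc (a := (0 : ℝ)) (b := x))
      (measure_ne_top (volume.restrict (Ioo (0 : ℝ) 1)) _) (1 : ℝ)) := by
    refine continuous_indicatorConstLp_set (by norm_num) fun x => ?_
    have hb : ∀ y, volume.restrict (Ioo (0 : ℝ) 1) (symmDiff (Ioc 0 y) (Ioc 0 x))
        ≤ ENNReal.ofReal |y - x| := fun y => by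
      refine (Measure.restrict_apply_le _ _).trans ?_
      have : symmDiff (Ioc 0 y) (Ioc 0 x) ⊆ uIoc x y := by
        intro s hs
        simp only [mem_symmDiff, mem_Ioc, mem_uIoc] at hs ⊢
        grind
      refine (measure_mono this).trans ?_
      rw [Real.volume_uIoc]
    refine tendsto_of_tendsto_of_tendsto_of_le_of_le tendsto_const_nhds ?_
      (fun _ => bot_le) hb
    have : Filter.Tendsto (fun y : ℝ => ENNReal.ofReal |y - x|) (nhds x)
        (nhds (ENNReal.ofReal |x - x|)) :=
      (ENNReal.continuous_ofReal.comp (continuous_id.sub continuous_const).abs).tendsto x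
    simpa using this
  have h2 : Continuous (fun q : ℝ × L2 => (⟪indicatorConstLp (E := ℝ) 2
      (measurableSet_Ioc (a := (0 : ℝ)) (b := q.1))
      (measure_ne_top (volume.restrict (Ioo (0 : ℝ) 1)) _) (1 : ℝ), q.2⟫ : ℝ)) :=
    (h.comp continuous_fst).inner continuous_snd
  exact h2

lemma L2.prim_zero (g : L2) : L2.prim 0 g = 0 := by
  rw [L2.prim_apply (by simp)]; simp

lemma L2.abs_prim_le (x : ℝ) (g : L2) : |L2.prim x g| ≤ ‖g‖ := by
  have h1 : ‖(indicatorConstLp (E := ℝ) 2 (measurableSet_Ioc (a := (0 : ℝ)) (b := x))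
      (measure_ne_top (volume.restrict (Ioo (0 : ℝ) 1)) _) (1 : ℝ))‖ ≤ 1 := by
    refine norm_indicatorConstLp_le.trans ?_
    have : (volume.restrict (Ioo (0 : ℝ) 1)).real (Ioc 0 x) ≤ 1 := by
      have h := measureReal_mono (μ := volume.restrict (Ioo (0 : ℝ) 1)) (subset_univ (Ioc 0 x))
      simpa using h
    rw [norm_one, one_mul]
    exact Real.rpow_le_one measureReal_nonneg this (by norm_num)
  refine (norm_inner_le_norm (𝕜 := ℝ) _ g).trans ?_
  exact mul_le_of_le_one_left (norm_nonneg _) h1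

lemma L2.memLp_of_continuousOn {f : ℝ → ℝ} (hf : ContinuousOn f (Icc 0 1)) :
    MemLp f 2 (volume.restrict (Ioo (0 : ℝ) 1)) := by
  obtain ⟨C, hC⟩ := isCompact_Icc.exists_bound_of_continuousOn hf
  refine MemLp.of_bound ((hf.mono Ioo_subset_Icc_self).aestronglyMeasurable measurableSet_Ioo) C ?_
  filter_upwards [ae_restrict_mem measurableSet_Ioo] with x hx
  exact hC x (Ioo_subset_Icc_self hx)

lemma L2.inner_eq (f g : L2) : (⟪f, g⟫ : ℝ) = ∫ s in (0 : ℝ)..1, f s * g s := by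
  rw [L2.inner_def, intervalIntegral.integral_of_le zero_le_one, integral_Ioc_eq_integral_Ioo]
  refine integral_congr_ae (ae_of_all _ fun s => ?_)
  simp [mul_comm]

lemma L2.norm_sq_eq (f : L2) : ‖f‖ ^ 2 = ∫ s in (0 : ℝ)..1, f s ^ 2 := by
  rw [← real_inner_self_eq_norm_sq, L2.inner_eq]
  simp only [sq]

/-! ### Boundary values -/

lemma IsPrimitive.prim {g y : L2} {a : ℝ} (h : IsPrimitive g a y) :
    ∀ᵐ x ∂(volume.restrict (Ioo (0 : ℝ) 1)), y x = a + L2.prim x g := by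
  filter_upwards [h, ae_restrict_mem measurableSet_Ioo] with x hx hm
  rw [hx, L2.prim_apply (Ioo_subset_Icc_self hm)]

lemma isPrimitive_iff {g y : L2} {a : ℝ} : IsPrimitive g a y ↔ ∀ x ∈ Icc (0 : ℝ) 1,
    L2.prim x y = ∫ s in (0 : ℝ)..x, (a + L2.prim s g) := by
  refine ⟨fun h x hx => L2.prim_congr hx h.prim, fun h => ?_⟩
  have hc : Continuous (fun s => a + L2.prim s g) :=
    continuous_const.add (L2.continuous_prim.comp (continuous_id.prodMk continuous_const))
  have hm := L2.memLp_of_continuousOn hc.continuousOn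
  have e : y = hm.toLp := L2.ext_of_prim fun x hx => by
    rw [h x hx, L2.prim_congr hx hm.coeFn_toLp]
  filter_upwards [hm.coeFn_toLp, ae_restrict_mem measurableSet_Ioo] with x hx hxm
  rw [e, hx, L2.prim_apply (Ioo_subset_Icc_self hxm)]

lemma exists_isPrimitive (g : L2) (a : ℝ) : ∃ y, IsPrimitive g a y := by
  have hc : Continuous (fun s => a + L2.prim s g) :=
    continuous_const.add (L2.continuous_prim.comp (continuous_id.prodMk continuous_const))
  have hm := L2.memLp_of_continuousOn hc.continuousOn
  refine ⟨hm.toLp, ?_⟩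
  filter_upwards [hm.coeFn_toLp, ae_restrict_mem measurableSet_Ioo] with x hx hxm
  rw [hx, L2.prim_apply (Ioo_subset_Icc_self hxm)]

lemma H1.right_eq (y : H1) : y.right = y.left + L2.prim 1 y.dx := by
  rw [H1.right, L2.prim_apply (by simp)]

lemma H1.norm_sq (y : H1) : ‖y‖ ^ 2 = ‖y.fn‖ ^ 2 + ‖y.dx‖ ^ 2 :=
  WithLp.prod_norm_sq_eq_of_L2 y.1

lemma H1.continuous_fn : Continuous H1.fn :=
  (WithLp.continuous_fst (p := 2) (α := L2) (β := L2)).comp continuous_subtype_val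

lemma H1.continuous_dx : Continuous H1.dx :=
  (WithLp.continuous_snd (p := 2) (α := L2) (β := L2)).comp continuous_subtype_val

/-- The boundary value at `0` as a function of the `L²` classes of `y` and `y'`: average
`y(0) = y(x) - ∫₀ˣ y'` over `0 < x < 1`. -/
lemma H1.left_eq (y : H1) :
    y.left = L2.prim 1 y.fn - ∫ s in (0 : ℝ)..1, L2.prim s y.dx := by
  have h := isPrimitive_iff.1 y.left_spec 1 (by simp)
  have hc : Continuous (fun s => L2.prim s y.dx) :=
    L2.continuous_prim.comp (continuous_id.prodMk continuous_const)
  rw [h, intervalIntegral.integral_add (by simp) (hc.intervalIntegrable _ _)]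
  simp

lemma H1.continuous_left : Continuous H1.left := by
  let l : H1 →ₗ[ℝ] ℝ := ⟨⟨H1.left, H1.left_add⟩, H1.left_smul⟩
  refine (l.mkContinuous 2 fun y => ?_).continuous
  have h0 := H1.norm_sq y
  have h1 : ‖y.fn‖ ≤ ‖y‖ :=
    abs_le_of_sq_le_sq' (by nlinarith [sq_nonneg ‖y.dx‖]) (norm_nonneg _) |>.2
  have h2 : ‖y.dx‖ ≤ ‖y‖ :=
    abs_le_of_sq_le_sq' (by nlinarith [sq_nonneg ‖y.fn‖]) (norm_nonneg _) |>.2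
  have h3 : ‖∫ s in (0 : ℝ)..1, L2.prim s y.dx‖ ≤ ‖y.dx‖ * |1 - 0| :=
    intervalIntegral.norm_integral_le_of_norm_le_const fun s _ => L2.abs_prim_le s _
  have h4 := L2.abs_prim_le 1 y.fn
  change ‖y.left‖ ≤ _
  rw [H1.left_eq]
  refine (norm_sub_le _ _).trans ?_
  simp only [Real.norm_eq_abs, sub_zero, abs_one, mul_one] at h3 ⊢
  linarith

lemma State.continuous_pos : Continuous State.pos :=
  WithLp.continuous_fst (p := 2) (α := H1) (β := L2)

lemma State.continuous_vel : Continuous State.vel :=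
  WithLp.continuous_snd (p := 2) (α := H1) (β := L2)

/-- Integration by parts on `(0,1)`. -/
lemma IsPrimitive.inner_add_inner {g y : L2} {a : ℝ} (h : IsPrimitive g a y) (φ : H1) :
    (⟪g, φ.fn⟫ : ℝ) + ⟪y, φ.dx⟫ = (a + L2.prim 1 g) * φ.right - a * φ.left := by
  have h1 : (1 : ℝ) ∈ Icc (0 : ℝ) 1 := by simp
  have e := integral_mul_add_mul_primitive (F := g) (G := φ.dx)
    (f := fun x => a + ∫ s in (0 : ℝ)..x, g s)
    (g := fun x => φ.left + ∫ s in (0 : ℝ)..x, φ.dx s) zero_le_one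
    (g.intervalIntegrable h1) (φ.dx.intervalIntegrable h1) (by simp) (by simp)
  simp only [intervalIntegral.integral_same, add_zero] at e
  rw [H1.right, L2.prim_apply h1, ← e, L2.inner_def, L2.inner_def,
    ← integral_add (L2.integrable_inner _ _) (L2.integrable_inner _ _),
    intervalIntegral.integral_of_le zero_le_one, integral_Ioc_eq_integral_Ioo]
  refine integral_congr_ae ?_
  filter_upwards [h, φ.left_spec] with x hx hx'
  simp only [hx, hx', RCLike.inner_apply, conj_trivial]
  ring

/-- Every element of `L²(0,1)` is the derivative of an element of `H¹(0,1)` with a prescribed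
value at `0`. -/
lemma exists_H1 (g : L2) (a : ℝ) : ∃ φ : H1, φ.dx = g ∧ φ.left = a := by
  obtain ⟨y, hy⟩ := exists_isPrimitive g a
  exact ⟨⟨WithLp.toLp 2 (y, g), a, hy⟩, rfl, IsPrimitive.unique (H1.left_spec _) hy⟩

/-! ### The weak formulation in integrated form -/

lemma integral_inner_L2 {h : ℝ → L2} {t : ℝ} (ht : 0 ≤ t) (hc : ContinuousOn h (Icc 0 t)) (ψ : L2) :
    ∫ s in (0 : ℝ)..t, (⟪h s, ψ⟫ : ℝ) = ⟪∫ s in (0 : ℝ)..t, h s, ψ⟫ := by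
  have hi : IntervalIntegrable h volume 0 t := hc.intervalIntegrable_of_Icc ht
  have := (innerSL ℝ ψ).intervalIntegral_comp_comm hi
  simp only [innerSL_apply_apply] at this
  rw [real_inner_comm, ← this]
  simp only [real_inner_comm]

lemma integral_prim {h : ℝ → L2} {t : ℝ} (ht : 0 ≤ t) (hc : ContinuousOn h (Icc 0 t)) (x : ℝ) :
    ∫ s in (0 : ℝ)..t, L2.prim x (h s) = L2.prim x (∫ s in (0 : ℝ)..t, h s) :=
  (L2.prim x).intervalIntegral_comp_comm (hc.intervalIntegrable_of_Icc ht)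

/-- `∫₀ᵗ ∂ₓy(s) ds`, as an element of `L²(0,1)`. -/
noncomputable def intDx (x : ℝ → State) (t : ℝ) : L2 := ∫ s in (0 : ℝ)..t, (x s).pos.dx

lemma continuousOn_dx {x : ℝ → State} (hx : ContinuousOn x (Ici 0)) :
    ContinuousOn (fun s => (x s).pos.dx) (Ici 0) :=
  (H1.continuous_dx.comp State.continuous_pos).comp_continuousOn hx

lemma continuousOn_vel {x : ℝ → State} (hx : ContinuousOn x (Ici 0)) :
    ContinuousOn (fun s => (x s).vel) (Ici 0) :=
  State.continuous_vel.comp_continuousOn hx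

lemma continuousOn_left {x : ℝ → State} (hx : ContinuousOn x (Ici 0)) :
    ContinuousOn (fun s => (x s).pos.left) (Ici 0) :=
  (H1.continuous_left.comp State.continuous_pos).comp_continuousOn hx

/-- The weak formulation at the left end, with the test functions removed: `∫₀ᵗ y_x(s) ds` is in
`H¹(0,1)`, has derivative `y_t(t) - y_t(0)`, and its value at `0` is the integrated flux. Testing
with the `φ` of arbitrary derivative and `φ(1) = 0` shows that it equals this primitive. -/
lemma waveLeft_iff {x : ℝ → State} (hx : ContinuousOn x (Ici 0)) {P : ℝ → ℝ} : WaveLeft x P ↔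
    ∀ t, 0 ≤ t → IsPrimitive ((x t).vel - (x 0).vel) (P t) (intDx x t) := by
  have hd : ∀ t, ContinuousOn (fun s => (x s).pos.dx) (Icc 0 t) := fun t =>
    (continuousOn_dx hx).mono Icc_subset_Ici_self
  constructor
  · intro h t ht
    obtain ⟨y, hy⟩ := exists_isPrimitive ((x t).vel - (x 0).vel) (P t)
    suffices intDx x t = y by rw [this]; exact hy
    refine ext_inner_right ℝ fun ψ => ?_
    obtain ⟨φ, hφ, hl⟩ := exists_H1 ψ (-L2.prim 1 ψ)
    have hr : φ.right = 0 := by rw [H1.right_eq, hφ, hl]; ring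
    have e1 := h φ hr t ht
    have e2 := hy.inner_add_inner φ
    rw [integral_inner_L2 ht (hd t), ← inner_sub_left, hφ] at e1
    rw [hr, hφ] at e2
    rw [intDx]
    linarith
  · intro h φ hr t ht
    have e2 := (h t ht).inner_add_inner φ
    rw [integral_inner_L2 ht (hd t), ← inner_sub_left]
    rw [hr, intDx] at e2
    linarith

/-- The weak formulation at the right end: the value of the primitive at `1` is prescribed. -/
lemma waveRight_iff {x : ℝ → State} (hx : ContinuousOn x (Ici 0)) {Q : ℝ → ℝ} : WaveRight x Q ↔
    ∀ t, 0 ≤ t → IsPrimitive ((x t).vel - (x 0).vel)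
      (Q t - L2.prim 1 ((x t).vel - (x 0).vel)) (intDx x t) := by
  have hd : ∀ t, ContinuousOn (fun s => (x s).pos.dx) (Icc 0 t) := fun t =>
    (continuousOn_dx hx).mono Icc_subset_Ici_self
  constructor
  · intro h t ht
    obtain ⟨y, hy⟩ := exists_isPrimitive ((x t).vel - (x 0).vel)
      (Q t - L2.prim 1 ((x t).vel - (x 0).vel))
    suffices intDx x t = y by rw [this]; exact hy
    refine ext_inner_right ℝ fun ψ => ?_
    obtain ⟨φ, hφ, hl⟩ := exists_H1 ψ 0
    have e1 := h φ hl t ht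
    have e2 := hy.inner_add_inner φ
    rw [integral_inner_L2 ht (hd t), ← inner_sub_left, hφ] at e1
    rw [hl, hφ] at e2
    rw [intDx]
    linarith
  · intro h φ hr t ht
    have e2 := (h t ht).inner_add_inner φ
    rw [integral_inner_L2 ht (hd t), ← inner_sub_left]
    rw [hr, intDx] at e2
    linarith

/-- The boundary fluxes at the two ends differ by the change of the momentum `∫₀¹ y_t`. -/
lemma waveRight_of_waveLeft {x : ℝ → State} (hx : ContinuousOn x (Ici 0)) {P Q : ℝ → ℝ}
    (h : WaveLeft x P) (hQ : ∀ t, 0 ≤ t → Q t = P t + L2.prim 1 ((x t).vel - (x 0).vel)) :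
    WaveRight x Q := by
  rw [waveRight_iff hx]
  intro t ht
  rw [hQ t ht, add_sub_cancel_right]
  exact (waveLeft_iff hx).1 h t ht

/-- A boundary flux is determined almost everywhere by its integrals. -/
lemma HasRightFlux.ae_unique {x : ℝ → State} {g g' : ℝ → ℝ} (h : HasRightFlux x g)
    (h' : HasRightFlux x g') : g =ᵐ[volume.restrict (Ioi 0)] g' := by
  obtain ⟨φ, hφ, hl⟩ := exists_H1 (MemLp.toLp (fun _ => (1 : ℝ)) (memLp_const 1)) 0
  have hr : φ.right = 1 := by
    rw [H1.right_eq, hφ, hl, L2.prim_congr (by simp) (MemLp.coeFn_toLp _)]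
    simp
  have key : ∀ t, 0 ≤ t → ∫ s in (0 : ℝ)..t, g s = ∫ s in (0 : ℝ)..t, g' s := fun t ht => by
    have e1 := h.2 φ hl t ht
    have e2 := h'.2 φ hl t ht
    rw [hr] at e1 e2
    linarith
  have hi : ∀ {f : ℝ → ℝ}, LocallyIntegrableOn f (Ici 0) → ∀ n : ℕ,
      IntervalIntegrable f volume 0 n := fun {f} hf n =>
    (intervalIntegrable_iff_integrableOn_Icc_of_le n.cast_nonneg).2
      (hf.integrableOn_compact_subset Icc_subset_Ici_self isCompact_Icc)
  have h3 : ∀ᵐ s, ∀ n : ℕ, s ∈ Ioo (0 : ℝ) n → g s = g' s := ae_all_iff.2 fun n =>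
    ae_eq_of_integral_eq n.cast_nonneg (hi h.1 n) (hi h'.1 n) fun t ht => key t ht.1
  refine (ae_restrict_iff' measurableSet_Ioi).2 ?_
  filter_upwards [h3] with s hs hs0
  obtain ⟨n, hn⟩ := exists_nat_gt s
  exact hs n ⟨hs0, hn⟩

/-! ### Characteristics -/

/-- A continuous function `Φ` on `[0,∞) × [0,1]` that satisfies `Φ_t = Φ_x`, in the form integrated
over `(0,t) × (0,x)`, is constant along the characteristics `t + x = const`. The function
`∫₀ˣ Φ(t,ξ) dξ + ∫₀ᵗ Φ(s,0) ds` has both partial derivatives equal to `Φ`, so it is a function of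
`t + x`, and so is its derivative. -/
lemma eq_of_transport {Φ : ℝ → ℝ → ℝ}
    (hΦ : ContinuousOn (Function.uncurry Φ) (Ici 0 ×ˢ Icc 0 1))
    (h : ∀ t, 0 ≤ t → ∀ x ∈ Icc (0 : ℝ) 1,
      (∫ ξ in (0 : ℝ)..x, Φ t ξ) - (∫ ξ in (0 : ℝ)..x, Φ 0 ξ)
        = ∫ s in (0 : ℝ)..t, (Φ s x - Φ s 0))
    {t x : ℝ} (ht : 0 ≤ t) (hx : x ∈ Icc (0 : ℝ) 1) : Φ t x = Φ (t + x) 0 := by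
  -- a continuous extension of `Φ` to the plane
  set Ψ : ℝ → ℝ → ℝ := fun t x => Φ (max t 0) (max 0 (min x 1)) with hΨ
  have hΨc : Continuous (Function.uncurry Ψ) := by
    have hp : Continuous (fun q : ℝ × ℝ => (max q.1 0, max 0 (min q.2 1))) := by fun_prop
    exact hΦ.comp_continuous hp fun q => ⟨by simp, by simp⟩
  have hΨe : ∀ {t x : ℝ}, 0 ≤ t → x ∈ Icc (0 : ℝ) 1 → Ψ t x = Φ t x := fun {t x} ht hx => by
    simp [hΨ, max_eq_left ht, min_eq_left hx.2, max_eq_right hx.1]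
  have hc1 : ∀ t, Continuous (Ψ t) := fun t => hΨc.comp (by fun_prop : Continuous fun x => (t, x))
  have hc2 : ∀ x, Continuous (fun t => Ψ t x) := fun x =>
    hΨc.comp (by fun_prop : Continuous fun t => (t, x))
  set F : ℝ → ℝ → ℝ := fun t x => (∫ ξ in (0 : ℝ)..x, Ψ t ξ) + ∫ s in (0 : ℝ)..t, Ψ s 0 with hF
  have hFc : Continuous (Function.uncurry F) := by
    refine Continuous.add ?_ ?_
    · exact intervalIntegral.continuous_parametric_intervalIntegral_of_continuous
        (f := fun (q : ℝ × ℝ) ξ => Ψ q.1 ξ)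
        (hΨc.comp (by fun_prop : Continuous fun q : (ℝ × ℝ) × ℝ => (q.1.1, q.2))) continuous_snd
    · exact (intervalIntegral.continuous_primitive
        (fun a b => (hc2 0).intervalIntegrable a b) 0).comp continuous_fst
  have hF2 : ∀ {t x : ℝ}, 0 ≤ t → x ∈ Icc (0 : ℝ) 1 →
      F t x = (∫ ξ in (0 : ℝ)..x, Ψ 0 ξ) + ∫ s in (0 : ℝ)..t, Ψ s x := fun {t x} ht hx => by
    have e := h t ht x hx
    have ex : ∀ {τ : ℝ}, 0 ≤ τ → ∫ ξ in (0 : ℝ)..x, Φ τ ξ = ∫ ξ in (0 : ℝ)..x, Ψ τ ξ :=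
      fun {τ} hτ => intervalIntegral.integral_congr fun ξ hξ => by
        rw [uIcc_of_le hx.1] at hξ
        exact (hΨe hτ ⟨hξ.1, hξ.2.trans hx.2⟩).symm
    have et : ∫ s in (0 : ℝ)..t, (Φ s x - Φ s 0) = ∫ s in (0 : ℝ)..t, (Ψ s x - Ψ s 0) :=
      intervalIntegral.integral_congr fun s hs => by
        rw [uIcc_of_le ht] at hs
        simp only [hΨe hs.1 hx, hΨe hs.1 (left_mem_Icc.2 zero_le_one)]
    rw [ex ht, ex le_rfl, et, intervalIntegral.integral_sub ((hc2 x).intervalIntegrable _ _)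
      ((hc2 0).intervalIntegrable _ _)] at e
    simp only [hF]
    linarith
  have dF2 : ∀ t x, HasDerivAt (F t) (Ψ t x) x := fun t x =>
    ((hc1 t).integral_hasStrictDerivAt 0 x).hasDerivAt.add_const _
  have dF1 : ∀ {t x : ℝ}, 0 < t → x ∈ Icc (0 : ℝ) 1 → HasDerivAt (fun t => F t x) (Ψ t x) t :=
    fun {t x} ht hx => by
      refine HasDerivAt.congr_of_eventuallyEq
        (((hc2 x).integral_hasStrictDerivAt 0 t).hasDerivAt.const_add (∫ ξ in (0 : ℝ)..x, Ψ 0 ξ)) ?_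
      filter_upwards [Ioi_mem_nhds ht] with s hs using hF2 (le_of_lt hs) hx
  have dF : ∀ {t x : ℝ}, 0 < t → x ∈ Ioo (0 : ℝ) 1 → HasStrictFDerivAt (Function.uncurry F)
      ((ContinuousLinearMap.toSpanSingleton ℝ (Ψ t x)).coprod
        (ContinuousLinearMap.toSpanSingleton ℝ (Ψ t x))) (t, x) := fun {t x} ht hx => by
    have hcl : Continuous (Function.uncurry fun t x =>
        ContinuousLinearMap.toSpanSingleton ℝ (Ψ t x)) :=
      (ContinuousLinearMap.toSpanSingletonCLE (𝕜 := ℝ) (E := ℝ)).continuous.comp hΨc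
    refine hasStrictFDerivAt_uncurry_coprod (u := (t, x)) (f := F)
      (f₁ := fun t x => ContinuousLinearMap.toSpanSingleton ℝ (Ψ t x))
      (f₂ := fun t x => ContinuousLinearMap.toSpanSingleton ℝ (Ψ t x)) ?_ ?_
      hcl.continuousAt hcl.continuousAt
    · filter_upwards [prod_mem_nhds (Ioi_mem_nhds ht) (Icc_mem_nhds hx.1 hx.2)] with v hv
      exact (dF1 hv.1 hv.2).hasFDerivAt
    · exact Filter.Eventually.of_forall fun v => (dF2 v.1 v.2).hasFDerivAt
  have hconst : ∀ {t x : ℝ}, 0 ≤ t → x ∈ Icc (0 : ℝ) 1 → F t x = F (t + x) 0 := fun {t x} ht hx => by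
    rcases hx.1.eq_or_lt with h0 | h0
    · rw [← h0, add_zero]
    obtain ⟨r, hr, e⟩ := exists_hasDerivAt_eq_slope (fun r => F (t + x - r) r) (fun _ => 0) h0
      (hFc.comp (by fun_prop : Continuous fun r : ℝ => (t + x - r, r))).continuousOn
      fun r hr => by
        have hd := (dF (t := t + x - r) (x := r) (by linarith [hr.2])
          ⟨hr.1, hr.2.trans_le hx.2⟩).hasFDerivAt.comp_hasDerivAt
          (f := fun r : ℝ => (t + x - r, r)) r (((hasDerivAt_id r).const_sub (t + x)).prodMk (hasDerivAt_id r))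
        convert! hd using 1
        simp
    have e' := (div_eq_zero_iff.1 e.symm).resolve_right (by linarith)
    simp only [add_sub_cancel_right, sub_zero] at e'
    linarith
  have d1 : HasDerivWithinAt (F t) (Ψ t x) (Icc 0 1) x := (dF2 t x).hasDerivWithinAt
  have d2 : HasDerivWithinAt (F t) (Ψ (t + x) 0) (Icc 0 1) x := by
    have hd := (((hc2 0).integral_hasStrictDerivAt 0 (t + x)).hasDerivAt.comp_const_add t x)
    refine hd.hasDerivWithinAt.congr (fun y hy => ?_) ?_
    · rw [hconst ht hy]; simp [hF]
    · rw [hconst ht hx]; simp [hF]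
  have e := (uniqueDiffOn_Icc zero_lt_one x hx).eq_deriv _ d1 d2
  rwa [hΨe ht hx, hΨe (add_nonneg ht hx.1) (left_mem_Icc.2 zero_le_one)] at e

/-- D'Alembert's formula for the conjugate pair `Y_t = Θ_x`, `Θ_t = Y_x` on `(0,1)` with
`Y = 0` at `x = 1`, where the wave is reflected. -/
lemma dAlembert {Y Θ : ℝ → ℝ → ℝ}
    (hYc : ContinuousOn (Function.uncurry Y) (Ici 0 ×ˢ Icc 0 1))
    (hΘc : ContinuousOn (Function.uncurry Θ) (Ici 0 ×ˢ Icc 0 1))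
    (hY : ∀ t, 0 ≤ t → ∀ x ∈ Icc (0 : ℝ) 1,
      (∫ ξ in (0 : ℝ)..x, Y t ξ) - (∫ ξ in (0 : ℝ)..x, Y 0 ξ)
        = ∫ s in (0 : ℝ)..t, (Θ s x - Θ s 0))
    (hΘ : ∀ t, 0 ≤ t → ∀ x ∈ Icc (0 : ℝ) 1,
      (∫ ξ in (0 : ℝ)..x, Θ t ξ) - (∫ ξ in (0 : ℝ)..x, Θ 0 ξ)
        = ∫ s in (0 : ℝ)..t, (Y s x - Y s 0))
    (h1 : ∀ t, 0 ≤ t → Y t 1 = 0) {t x : ℝ} (ht : 0 ≤ t) (hx : x ∈ Icc (0 : ℝ) 1) :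
    Y t x + Θ t x = Y (t + x) 0 + Θ (t + x) 0 ∧
      Y t x - Θ t x = -(Y (t + 2 - x) 0 + Θ (t + 2 - x) 0) := by
  have h01 : (0 : ℝ) ∈ Icc (0 : ℝ) 1 := by simp
  have h11 : (1 : ℝ) ∈ Icc (0 : ℝ) 1 := by simp
  have ix : ∀ {Z : ℝ → ℝ → ℝ}, ContinuousOn (Function.uncurry Z) (Ici 0 ×ˢ Icc 0 1) →
      ∀ {t x y : ℝ}, 0 ≤ t → x ∈ Icc (0 : ℝ) 1 → y ∈ Icc (0 : ℝ) 1 →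
        IntervalIntegrable (Z t) volume x y := fun {Z} hZ {t x y} ht hx hy => by
    refine ContinuousOn.intervalIntegrable ?_
    have hc : ContinuousOn (fun ξ : ℝ => (t, ξ)) (uIcc x y) := by fun_prop
    exact hZ.comp hc fun ξ hξ => ⟨ht, uIcc_subset_Icc hx hy hξ⟩
  have it : ∀ {Z : ℝ → ℝ → ℝ}, ContinuousOn (Function.uncurry Z) (Ici 0 ×ˢ Icc 0 1) →
      ∀ {t x : ℝ}, 0 ≤ t → x ∈ Icc (0 : ℝ) 1 →
        IntervalIntegrable (fun s => Z s x) volume 0 t := fun {Z} hZ {t x} ht hx => by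
    refine ContinuousOn.intervalIntegrable ?_
    have hc : ContinuousOn (fun s : ℝ => (s, x)) (uIcc 0 t) := by fun_prop
    exact hZ.comp hc fun s hs => ⟨(uIcc_of_le ht ▸ hs).1, hx⟩
  have hp : ∀ {t x : ℝ}, 0 ≤ t → x ∈ Icc (0 : ℝ) 1 →
      Y t x + Θ t x = Y (t + x) 0 + Θ (t + x) 0 := fun {t x} ht hx => by
    refine eq_of_transport (Φ := fun t x => Y t x + Θ t x) (hYc.add hΘc) ?_ ht hx
    intro t ht x hx
    have e1 := hY t ht x hx
    have e2 := hΘ t ht x hx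
    rw [intervalIntegral.integral_add (ix hYc ht h01 hx) (ix hΘc ht h01 hx),
      intervalIntegral.integral_add (ix hYc le_rfl h01 hx) (ix hΘc le_rfl h01 hx),
      add_sub_add_comm, e1, e2, ← intervalIntegral.integral_add
        ((it hΘc ht hx).sub (it hΘc ht h01)) ((it hYc ht hx).sub (it hYc ht h01))]
    congr 1; ext s; ring
  have hm : ∀ {t x : ℝ}, 0 ≤ t → x ∈ Icc (0 : ℝ) 1 →
      Y t (1 - x) - Θ t (1 - x) = Y (t + x) (1 - 0) - Θ (t + x) (1 - 0) := fun {t x} ht hx => by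
    have hr : ContinuousOn (fun q : ℝ × ℝ => (q.1, 1 - q.2)) (Ici 0 ×ˢ Icc 0 1) := by fun_prop
    refine eq_of_transport (Φ := fun t x => Y t (1 - x) - Θ t (1 - x))
      ((hYc.sub hΘc).comp hr ?_) ?_ ht hx
    · rintro ⟨t, x⟩ ⟨h1, h2, h3⟩
      simp only at h2 h3
      exact ⟨h1, by simp only [mem_Icc]; constructor <;> linarith⟩
    intro t ht x hx
    have hx' : 1 - x ∈ Icc (0 : ℝ) 1 := ⟨by linarith [hx.2], by linarith [hx.1]⟩
    have sub : ∀ {τ : ℝ}, 0 ≤ τ → ∫ ξ in (0 : ℝ)..x, (Y τ (1 - ξ) - Θ τ (1 - ξ))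
        = ((∫ ξ in (0 : ℝ)..1, Y τ ξ) - ∫ ξ in (0 : ℝ)..(1 - x), Y τ ξ)
          - ((∫ ξ in (0 : ℝ)..1, Θ τ ξ) - ∫ ξ in (0 : ℝ)..(1 - x), Θ τ ξ) := fun {τ} hτ => by
      rw [intervalIntegral.integral_comp_sub_left (fun ξ => Y τ ξ - Θ τ ξ) 1, sub_zero,
        intervalIntegral.integral_sub (ix hYc hτ hx' h11) (ix hΘc hτ hx' h11),
        intervalIntegral.integral_interval_sub_left (ix hYc hτ h01 h11) (ix hYc hτ h01 hx'),
        intervalIntegral.integral_interval_sub_left (ix hΘc hτ h01 h11) (ix hΘc hτ h01 hx')]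
    have e1 := hY t ht _ hx'
    have e2 := hΘ t ht _ hx'
    have e3 := hY t ht _ h11
    have e4 := hΘ t ht _ h11
    rw [intervalIntegral.integral_sub (it hΘc ht hx') (it hΘc ht h01)] at e1
    rw [intervalIntegral.integral_sub (it hYc ht hx') (it hYc ht h01)] at e2
    rw [intervalIntegral.integral_sub (it hΘc ht h11) (it hΘc ht h01)] at e3
    rw [intervalIntegral.integral_sub (it hYc ht h11) (it hYc ht h01)] at e4
    rw [sub ht, sub le_rfl, sub_zero, intervalIntegral.integral_sub
      ((it hYc ht hx').sub (it hΘc ht hx')) ((it hYc ht h11).sub (it hΘc ht h11)),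
      intervalIntegral.integral_sub (it hYc ht hx') (it hΘc ht hx'),
      intervalIntegral.integral_sub (it hYc ht h11) (it hΘc ht h11)]
    linarith
  refine ⟨hp ht hx, ?_⟩
  have hx' : 1 - x ∈ Icc (0 : ℝ) 1 := ⟨by linarith [hx.2], by linarith [hx.1]⟩
  have hT : 0 ≤ t + (1 - x) := add_nonneg ht hx'.1
  have e1 := hm ht hx'
  have e2 := hp hT h11
  have e3 := h1 _ hT
  rw [sub_sub_cancel, sub_zero] at e1
  rw [show t + (1 - x) + 1 = t + 2 - x by ring] at e2
  rw [e1, ← e2, e3]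
  ring

/-! ### The neutral delay equation at the left end -/

/-- Measurable functions that are square integrable on bounded intervals of `[0,∞)`. -/
structure LocL2 (f : ℝ → ℝ) : Prop where
  meas : AEStronglyMeasurable f (volume.restrict (Ioi 0))
  sq : ∀ T, 0 ≤ T → IntervalIntegrable (fun s => f s ^ 2) volume 0 T

lemma intervalIntegrable_of_forall_zero {f : ℝ → ℝ}
    (h : ∀ T, 0 ≤ T → IntervalIntegrable f volume 0 T) {a b : ℝ} (ha : 0 ≤ a) (hb : 0 ≤ b) :
    IntervalIntegrable f volume a b := (h a ha).symm.trans (h b hb)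

namespace LocL2

variable {f g : ℝ → ℝ}

lemma meas_uIoc (hf : LocL2 f) {T : ℝ} (hT : 0 ≤ T) :
    AEStronglyMeasurable f (volume.restrict (uIoc 0 T)) := by
  rw [uIoc_of_le hT]
  exact hf.meas.mono_measure (Measure.restrict_mono Ioc_subset_Ioi_self le_rfl)

lemma mul (hf : LocL2 f) (hg : LocL2 g) {T : ℝ} (hT : 0 ≤ T) :
    IntervalIntegrable (fun s => f s * g s) volume 0 T := by
  refine ((hf.sq T hT).add (hg.sq T hT)).mono_fun ((hf.meas_uIoc hT).mul (hg.meas_uIoc hT)) ?_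
  refine Filter.Eventually.of_forall fun s => ?_
  simp only [Real.norm_eq_abs, abs_mul]
  rw [abs_of_nonneg (a := f s ^ 2 + g s ^ 2) (by positivity), ← sq_abs (f s), ← sq_abs (g s)]
  nlinarith [sq_nonneg (|f s| - |g s|), abs_nonneg (f s), abs_nonneg (g s)]

lemma add (hf : LocL2 f) (hg : LocL2 g) : LocL2 (fun s => f s + g s) where
  meas := hf.meas.add hg.meas
  sq T hT := by
    have h := ((hf.sq T hT).add (hg.sq T hT)).add ((hf.mul hg hT).const_mul 2)
    refine h.congr fun s _ => ?_
    ring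

lemma const_mul (hf : LocL2 f) (c : ℝ) : LocL2 (fun s => c * f s) where
  meas := hf.meas.const_mul c
  sq T hT := by simpa only [mul_pow] using (hf.sq T hT).const_mul (c ^ 2)

lemma of_continuousOn (hf : ContinuousOn f (Ici 0)) : LocL2 f where
  meas := (hf.mono Ioi_subset_Ici_self).aestronglyMeasurable measurableSet_Ioi
  sq T hT := ((hf.pow 2).mono (by rw [uIcc_of_le hT]; exact Icc_subset_Ici_self)).intervalIntegrable

lemma intervalIntegrable (hf : LocL2 f) {a b : ℝ} (ha : 0 ≤ a) (hb : 0 ≤ b) :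
    IntervalIntegrable f volume a b :=
  intervalIntegrable_of_forall_zero (fun T hT => by
    simpa using hf.mul (of_continuousOn (f := fun _ => 1) continuousOn_const) hT) ha hb

lemma sq' (hf : LocL2 f) {a b : ℝ} (ha : 0 ≤ a) (hb : 0 ≤ b) :
    IntervalIntegrable (fun s => f s ^ 2) volume a b :=
  intervalIntegrable_of_forall_zero hf.sq ha hb

lemma mul' (hf : LocL2 f) (hg : LocL2 g) {a b : ℝ} (ha : 0 ≤ a) (hb : 0 ≤ b) :
    IntervalIntegrable (fun s => f s * g s) volume a b :=
  intervalIntegrable_of_forall_zero (fun _ hT => hf.mul hg hT) ha hb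

lemma continuousOn_of_primitive (hf : LocL2 f) {y : ℝ → ℝ}
    (hy : ∀ t, 0 ≤ t → y t = y 0 + ∫ s in (0 : ℝ)..t, f s) : ContinuousOn y (Ici 0) := by
  intro t ht
  have h0 : 0 ≤ t + 1 := add_nonneg ht zero_le_one
  have h := continuousOn_primitive h0 (hf.intervalIntegrable le_rfl h0)
    fun x hx => hy x hx.1
  refine (h t ⟨ht, by linarith⟩).mono_of_mem_nhdsWithin ?_
  filter_upwards [self_mem_nhdsWithin, mem_nhdsWithin_of_mem_nhds
    (Iio_mem_nhds (show t < t + 1 by linarith))] with s h1 h2 using ⟨h1, le_of_lt h2⟩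

end LocL2

/-- The Cauchy–Schwarz inequality against the constant function `1`. -/
lemma sq_integral_le {f : ℝ → ℝ} {a b : ℝ} (hab : a ≤ b)
    (hf : IntervalIntegrable f volume a b)
    (hf2 : IntervalIntegrable (fun s => f s ^ 2) volume a b) :
    (∫ s in a..b, f s) ^ 2 ≤ (b - a) * ∫ s in a..b, f s ^ 2 := by
  rcases hab.eq_or_lt with rfl | hlt
  · simp
  set m := (∫ s in a..b, f s) with hm
  -- expand `0 ≤ ∫ (f - average)²`
  have h0 : 0 ≤ ∫ s in a..b, (f s ^ 2 - 2 * (m / (b - a)) * f s + (m / (b - a)) ^ 2) :=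
    intervalIntegral.integral_nonneg hab fun s _ => by
      nlinarith [sq_nonneg (f s - m / (b - a))]
  rw [intervalIntegral.integral_add (hf2.sub (hf.const_mul _)) (by simp),
    intervalIntegral.integral_sub hf2 (hf.const_mul _), intervalIntegral.integral_const_mul,
    intervalIntegral.integral_const, ← hm, smul_eq_mul] at h0
  have hpos : 0 < b - a := sub_pos.2 hlt
  have e : 2 * (m / (b - a)) * m = 2 * m ^ 2 / (b - a) := by ring
  have e' : (b - a) * (m / (b - a)) ^ 2 = m ^ 2 / (b - a) := by field_simp
  rw [e, e'] at h0
  have h1 : m ^ 2 / (b - a) ≤ ∫ s in a..b, f s ^ 2 := by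
    have : 2 * m ^ 2 / (b - a) = 2 * (m ^ 2 / (b - a)) := by ring
    linarith
  rw [div_le_iff₀ hpos] at h1
  linarith

/-- The solution of the reflected wave equation with damping at `x = 0`, seen at `x = 0`: `A` is the
incoming Riemann invariant `y_t + y_x` and `η` is the displacement. The field `trace` is
`y(0,t) = -∫₀¹ y_x(x,t) dx`, that is `y(1,t) = 0`; the field `ode` is the boundary condition at `0`,
integrated in time. -/
structure DelaySolution (c0 c1 : ℝ) (A η : ℝ → ℝ) : Prop where
  locL2 : LocL2 A
  trace : ∀ t, 0 ≤ t → η t = -(∫ s in t..t + 2, A s) / 2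
  ode : ∀ t, 0 ≤ t → η t = η 0 + ∫ s in (0 : ℝ)..t, ((1 - c0) * A s - c1 * η s)

namespace DelaySolution
variable {c0 c1 : ℝ} {A η : ℝ → ℝ}

lemma continuousOn (h : DelaySolution c0 c1 A η) : ContinuousOn η (Ici 0) := by
  -- the trace relation expresses `η` through the primitive of `A`
  have hM : ContinuousOn (fun t => ∫ s in (0 : ℝ)..t, A s) (Ici 0) :=
    h.locL2.continuousOn_of_primitive fun t _ => by simp
  have hM2 : ContinuousOn (fun t => ∫ s in (0 : ℝ)..t + 2, A s) (Ici 0) :=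
    hM.comp (by fun_prop : ContinuousOn (fun t : ℝ => t + 2) (Ici 0)) fun t ht => by
      simp only [mem_Ici] at *; linarith
  refine ((hM2.sub hM).neg.div_const 2).congr fun t ht => ?_
  have ht' : (0 : ℝ) ≤ t + 2 := by simp only [mem_Ici] at ht; linarith
  simp only [Pi.neg_apply, Pi.sub_apply]
  rw [h.trace t ht, intervalIntegral.integral_interval_sub_left
    (h.locL2.intervalIntegrable le_rfl ht') (h.locL2.intervalIntegrable le_rfl ht)]

lemma locL2_ode (h : DelaySolution c0 c1 A η) : LocL2 (fun s => (1 - c0) * A s - c1 * η s) := by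
  simpa only [sub_eq_add_neg, neg_mul] using
    (h.locL2.const_mul (1 - c0)).add ((LocL2.of_continuousOn h.continuousOn).const_mul (-c1))

/-- The reflection law `A(t + 2) = A(t) - 2 η'(t)`. -/
lemma delay (h : DelaySolution c0 c1 A η) {T : ℝ} (hT : 0 ≤ T) :
    ∀ᵐ t, t ∈ Ioo 0 T → A (t + 2) = A t - 2 * ((1 - c0) * A t - c1 * η t) := by
  have hs : IntervalIntegrable (fun t => A (t + 2)) volume 0 T := by
    have := (h.locL2.intervalIntegrable (a := 0 + 2) (b := T + 2)
      (by norm_num) (by linarith)).comp_add_right 2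
    simpa using this
  have hA := h.locL2.intervalIntegrable le_rfl hT
  refine ae_eq_of_integral_eq hT hs
    (hA.sub ((h.locL2_ode.intervalIntegrable le_rfl hT).const_mul 2)) fun t ht => ?_
  have hA' := h.locL2.intervalIntegrable le_rfl ht.1
  have ht2 : (0 : ℝ) ≤ t + 2 := by linarith [ht.1]
  have e1 := h.trace t ht.1
  have e0 := h.trace 0 le_rfl
  have eo := h.ode t ht.1
  rw [intervalIntegral.integral_sub hA' ((h.locL2_ode.intervalIntegrable le_rfl ht.1).const_mul 2),
    intervalIntegral.integral_const_mul, intervalIntegral.integral_comp_add_right]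
  rw [← intervalIntegral.integral_interval_sub_left (h.locL2.intervalIntegrable le_rfl ht2) hA']
    at e1
  rw [zero_add] at e0 ⊢
  rw [← intervalIntegral.integral_interval_sub_left (h.locL2.intervalIntegrable le_rfl ht2)
    (h.locL2.intervalIntegrable le_rfl zero_le_two)]
  linarith

/-- The energy balance: the energy decreases by the work of the damper. -/
lemma energy (h : DelaySolution c0 c1 A η) (h1 : c0 < 1) {t : ℝ} (ht : 0 ≤ t) :
    (∫ s in t..t + 2, A s ^ 2) + 2 * c1 / (1 - c0) * η t ^ 2
      + 4 * c0 / (1 - c0) * ∫ s in (0 : ℝ)..t, ((1 - c0) * A s - c1 * η s) ^ 2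
      = (∫ s in (0 : ℝ)..2, A s ^ 2) + 2 * c1 / (1 - c0) * η 0 ^ 2 := by
  have hX : (1 - c0) ≠ 0 := by linarith
  set D : ℝ → ℝ := fun s => (1 - c0) * A s - c1 * η s with hD
  have hDL : LocL2 D := h.locL2_ode
  have hη : LocL2 η := LocL2.of_continuousOn h.continuousOn
  have ht2 : (0 : ℝ) ≤ t + 2 := by linarith
  have s1 := (h.locL2.sq' le_rfl ht)
  have s2 := (h.locL2.sq' le_rfl ht2)
  have s3 := (h.locL2.sq' le_rfl zero_le_two)
  -- `(η²)' = 2 η η'`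
  have e1 : 2 * ∫ s in (0 : ℝ)..t, η s * D s = η t ^ 2 - η 0 ^ 2 := by
    have e := integral_mul_add_mul_primitive ht (hDL.intervalIntegrable le_rfl ht)
      (hDL.intervalIntegrable le_rfl ht) (fun x hx => h.ode x hx.1) (fun x hx => h.ode x hx.1)
    rw [← intervalIntegral.integral_const_mul, sq, sq, ← e]
    congr 1; ext s; ring
  have e2 : (∫ s in t..t + 2, A s ^ 2) - ∫ s in (0 : ℝ)..2, A s ^ 2
      = ∫ s in (0 : ℝ)..t, (A (s + 2) ^ 2 - A s ^ 2) := by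
    have hs : IntervalIntegrable (fun s => A (s + 2) ^ 2) volume 0 t := by
      have := (h.locL2.sq' (a := 0 + 2) (b := t + 2) (by norm_num) ht2).comp_add_right 2
      simpa using this
    rw [intervalIntegral.integral_sub hs s1,
      intervalIntegral.integral_comp_add_right (fun s => A s ^ 2), zero_add,
      ← intervalIntegral.integral_interval_sub_left s2 s1,
      ← intervalIntegral.integral_interval_sub_left s2 s3]
    ring
  have e3 : ∫ s in (0 : ℝ)..t, (A (s + 2) ^ 2 - A s ^ 2)
      = ∫ s in (0 : ℝ)..t, (-(4 * c0 / (1 - c0)) * D s ^ 2 - 4 * c1 / (1 - c0) * (η s * D s)) := by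
    refine intervalIntegral.integral_congr_ae ?_
    have hne : ∀ᵐ s : ℝ, s ≠ t := by simp [ae_iff, measure_singleton]
    filter_upwards [h.delay ht, hne] with s hs hst hm
    rw [uIoc_of_le ht] at hm
    rw [hs ⟨hm.1, lt_of_le_of_ne hm.2 hst⟩]
    simp only [hD]
    field_simp
    ring
  rw [e3, intervalIntegral.integral_sub ((hDL.sq' le_rfl ht).const_mul _)
    ((hη.mul' hDL le_rfl ht).const_mul _), intervalIntegral.integral_const_mul,
    intervalIntegral.integral_const_mul] at e2
  have e4 : 4 * c1 / (1 - c0) * ∫ s in (0 : ℝ)..t, η s * D s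
      = 2 * c1 / (1 - c0) * (η t ^ 2 - η 0 ^ 2) := by rw [← e1]; ring
  linarith

/-- The boundary condition at `0` says that `∫₀ᵗ y_x(0,s) ds` is
`∫₀ᵗ A(s) ds - (y(0,t) - y(0,0))`. -/
lemma flux_eq (h : DelaySolution c0 c1 A η) (h1 : c0 < 1) {t : ℝ} (ht : 0 ≤ t) :
    c1 / (1 - c0) * (∫ s in (0 : ℝ)..t, η s) + c0 / (1 - c0) * (η t - η 0)
      = (∫ s in (0 : ℝ)..t, A s) + η 0 - η t := by
  have hX : 1 - c0 ≠ 0 := by linarith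
  have eo := h.ode t ht
  rw [intervalIntegral.integral_sub ((h.locL2.intervalIntegrable le_rfl ht).const_mul _)
    (((LocL2.of_continuousOn h.continuousOn).intervalIntegrable le_rfl ht).const_mul _),
    intervalIntegral.integral_const_mul, intervalIntegral.integral_const_mul] at eo
  field_simp
  linear_combination eo

/-- Observability: the trace `η` is controlled by its derivative over one period of the wave. Here
the relation `η(t) = -½ ∫ₜᵗ⁺² A` enters; without it constants `A` would be stationary solutions. -/
lemma sq_le (h : DelaySolution c0 c1 A η) (h1 : c0 < 1) (hc1 : 0 < c1)
    {t : ℝ} (ht : 0 ≤ t) :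
    η t ^ 2 ≤ (1 + 2 * c1) ^ 2 / c1 ^ 2 *
      ∫ s in t..t + 2, ((1 - c0) * A s - c1 * η s) ^ 2 := by
  set D : ℝ → ℝ := fun s => (1 - c0) * A s - c1 * η s with hD
  have hDL : LocL2 D := h.locL2_ode
  have hη : LocL2 η := LocL2.of_continuousOn h.continuousOn
  have ht2 : (0 : ℝ) ≤ t + 2 := by linarith
  have hle : t ≤ t + 2 := by linarith
  have hDi := hDL.intervalIntegrable ht ht2
  have hηi := hη.intervalIntegrable ht ht2
  set δ := ∫ s in t..t + 2, |D s| with hδ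
  have hδ0 : 0 ≤ δ := intervalIntegral.integral_nonneg hle fun _ _ => abs_nonneg _
  have hinc : ∀ s ∈ Icc t (t + 2), η s - η t = ∫ r in t..s, D r := fun s hs => by
    rw [h.ode s (ht.trans hs.1), h.ode t ht, ← intervalIntegral.integral_interval_sub_left
      (hDL.intervalIntegrable le_rfl (ht.trans hs.1)) (hDL.intervalIntegrable le_rfl ht)]
    ring
  have hosc : ∀ s ∈ Icc t (t + 2), |η s - η t| ≤ δ := fun s hs => by
    rw [hinc s hs]
    refine (intervalIntegral.abs_integral_le_integral_abs hs.1).trans ?_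
    exact intervalIntegral.integral_mono_interval le_rfl hs.1 hs.2
      (ae_of_all _ fun _ => abs_nonneg _) hDi.abs
  have e1 : 2 * (1 - c0 + c1) * η t
      = -((η (t + 2) - η t) + c1 * ∫ s in t..t + 2, (η s - η t)) := by
    have et := h.trace t ht
    rw [hinc _ ⟨hle, le_rfl⟩]
    simp only [hD]
    rw [intervalIntegral.integral_sub ((h.locL2.intervalIntegrable ht ht2).const_mul _)
      (hηi.const_mul _), intervalIntegral.integral_const_mul, intervalIntegral.integral_const_mul,
      intervalIntegral.integral_sub hηi (by simp), intervalIntegral.integral_const, smul_eq_mul]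
    linear_combination (2 * (1 - c0)) * et
  have e2 : |∫ s in t..t + 2, (η s - η t)| ≤ 2 * δ := by
    have := intervalIntegral.norm_integral_le_of_norm_le_const (f := fun s => η s - η t)
      (a := t) (b := t + 2) (C := δ) fun s hs => by
        rw [uIoc_of_le hle] at hs
        exact hosc s (Ioc_subset_Icc_self hs)
    rw [Real.norm_eq_abs, add_sub_cancel_left, abs_two] at this
    linarith
  have e3 : 2 * (1 - c0 + c1) * |η t| ≤ (1 + 2 * c1) * δ := by
    have e := congrArg abs e1
    rw [abs_mul, abs_of_pos (by linarith : 0 < 2 * (1 - c0 + c1)), abs_neg] at e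
    rw [e]
    refine (abs_add_le _ _).trans ?_
    rw [abs_mul, abs_of_pos hc1]
    nlinarith [hosc (t + 2) ⟨hle, le_rfl⟩]
  have e4 : δ ^ 2 ≤ 2 * ∫ s in t..t + 2, D s ^ 2 := by
    have := sq_integral_le hle hDi.abs (by simpa only [sq_abs] using hDL.sq' ht ht2)
    simpa only [sq_abs, add_sub_cancel_left] using this
  have e5 : 2 * c1 * |η t| ≤ (1 + 2 * c1) * δ := by
    refine le_trans ?_ e3
    have := abs_nonneg (η t)
    nlinarith
  have e6 : (2 * c1 * |η t|) ^ 2 ≤ ((1 + 2 * c1) * δ) ^ 2 := by gcongr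
  have e7 : (0 : ℝ) ≤ ∫ s in t..t + 2, D s ^ 2 :=
    intervalIntegral.integral_nonneg hle fun _ _ => sq_nonneg _
  rw [div_mul_eq_mul_div, le_div_iff₀ (by positivity)]
  rw [mul_pow, mul_pow, mul_pow, sq_abs] at e6
  have e8 : (1 + 2 * c1) ^ 2 * δ ^ 2 ≤ (1 + 2 * c1) ^ 2 * (2 * ∫ s in t..t + 2, D s ^ 2) := by
    gcongr
  nlinarith [sq_nonneg (1 + 2 * c1)]

/-- The trace dissipates all of the energy: `η' ∈ L²(0,∞)` by the energy balance, hence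
`η ∈ L²(0,∞)` by observability, and `A` is a combination of the two. -/
lemma memLp (h : DelaySolution c0 c1 A η) (h0 : 0 < c0) (h1 : c0 < 1) (hc1 : 0 < c1) :
    MemLp A 2 (volume.restrict (Ioi 0)) := by
  have hX : 0 < 1 - c0 := by linarith
  set D : ℝ → ℝ := fun s => (1 - c0) * A s - c1 * η s with hD
  have hDL : LocL2 D := h.locL2_ode
  have hη : LocL2 η := LocL2.of_continuousOn h.continuousOn
  set E : ℝ → ℝ := fun t => ∫ s in (0 : ℝ)..t, D s ^ 2 with hE
  set V := (∫ s in (0 : ℝ)..2, A s ^ 2) + 2 * c1 / (1 - c0) * η 0 ^ 2 with hV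
  set K := V / (4 * c0 / (1 - c0)) with hK
  have hEK : ∀ t, 0 ≤ t → E t ≤ K := fun t ht => by
    have e := h.energy h1 ht
    have p1 : 0 ≤ ∫ s in t..t + 2, A s ^ 2 :=
      intervalIntegral.integral_nonneg (by linarith) fun _ _ => sq_nonneg _
    have p2 : 0 ≤ 2 * c1 / (1 - c0) * η t ^ 2 := by positivity
    rw [hK, le_div_iff₀ (by positivity), mul_comm]
    linarith
  have hE0 : ∀ t, 0 ≤ t → 0 ≤ E t := fun t ht =>
    intervalIntegral.integral_nonneg ht fun _ _ => sq_nonneg _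
  have hK0 : 0 ≤ K := (hE0 0 le_rfl).trans (hEK 0 le_rfl)
  have hEc : ContinuousOn E (Ici 0) := by
    intro t ht
    have h0 : 0 ≤ t + 1 := add_nonneg ht zero_le_one
    have hc := continuousOn_primitive (f := E) h0 (hDL.sq' le_rfl h0) fun x _ => by simp [hE]
    refine (hc t ⟨ht, by linarith⟩).mono_of_mem_nhdsWithin ?_
    filter_upwards [self_mem_nhdsWithin, mem_nhdsWithin_of_mem_nhds
      (Iio_mem_nhds (show t < t + 1 by linarith))] with s h1 h2 using ⟨h1, le_of_lt h2⟩
  have hEL : LocL2 E := .of_continuousOn hEc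
  -- `∫₀ᵀ (E(t + 2) - E(t)) dt` telescopes
  have hηK : ∀ T, 0 ≤ T → ∫ s in (0 : ℝ)..T, η s ^ 2 ≤ (1 + 2 * c1) ^ 2 / c1 ^ 2 * (2 * K) :=
    fun T hT => by
      have hT2 : 0 ≤ T + 2 := by linarith
      have hs : IntervalIntegrable (fun t => E (t + 2)) volume 0 T := by
        have := (hEL.intervalIntegrable (a := 0 + 2) (b := T + 2) (by norm_num) hT2).comp_add_right 2
        simpa using this
      have hEi := hEL.intervalIntegrable le_rfl hT
      have m : ∫ s in (0 : ℝ)..T, η s ^ 2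
          ≤ ∫ s in (0 : ℝ)..T, (1 + 2 * c1) ^ 2 / c1 ^ 2 * (E (s + 2) - E s) := by
        refine intervalIntegral.integral_mono_on hT (hη.sq' le_rfl hT)
          ((hs.sub hEi).const_mul _) fun s hs => ?_
        have e := h.sq_le h1 hc1 hs.1
        have h2 : 0 ≤ s + 2 := by linarith [hs.1]
        rwa [← intervalIntegral.integral_interval_sub_left (hDL.sq' le_rfl h2)
          (hDL.sq' le_rfl hs.1)] at e
      refine m.trans ?_
      rw [intervalIntegral.integral_const_mul]
      refine mul_le_mul_of_nonneg_left ?_ (by positivity)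
      rw [intervalIntegral.integral_sub hs hEi, intervalIntegral.integral_comp_add_right E, zero_add]
      have a1 := intervalIntegral.integral_add_adjacent_intervals
        (hEL.intervalIntegrable le_rfl zero_le_two) (hEL.intervalIntegrable zero_le_two hT2)
      have a2 := intervalIntegral.integral_add_adjacent_intervals hEi
        (hEL.intervalIntegrable hT hT2)
      have a3 : 0 ≤ ∫ s in (0 : ℝ)..2, E s :=
        intervalIntegral.integral_nonneg zero_le_two fun s hs => hE0 s hs.1
      have a4 : ∫ s in T..T + 2, E s ≤ ∫ s in T..T + 2, K :=
        intervalIntegral.integral_mono_on (by linarith) (hEL.intervalIntegrable hT hT2) (by simp)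
          fun s hs => hEK s (hT.trans hs.1)
      rw [intervalIntegral.integral_const, add_sub_cancel_left, smul_eq_mul] at a4
      linarith
  rw [memLp_two_iff_integrable_sq h.locL2.meas]
  refine integrableOn_Ioi_of_intervalIntegral_norm_bounded
    (I := 2 / (1 - c0) ^ 2 * (K + c1 ^ 2 * ((1 + 2 * c1) ^ 2 / c1 ^ 2 * (2 * K)))) (l := Filter.atTop)
    (b := fun T : ℝ => T) 0 (fun T => ?_) Filter.tendsto_id ?_
  · rcases le_total 0 T with hT | hT
    · exact (intervalIntegrable_iff_integrableOn_Ioc_of_le hT).1 (h.locL2.sq T hT)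
    · simp [Ioc_eq_empty_of_le hT]
  filter_upwards [Filter.eventually_ge_atTop 0] with T hT
  have m : ∫ s in (0 : ℝ)..T, ‖A s ^ 2‖
      ≤ ∫ s in (0 : ℝ)..T, 2 / (1 - c0) ^ 2 * (D s ^ 2 + c1 ^ 2 * η s ^ 2) := by
    refine intervalIntegral.integral_mono_on hT (h.locL2.sq' le_rfl hT).norm
      (((hDL.sq' le_rfl hT).add ((hη.sq' le_rfl hT).const_mul _)).const_mul _) fun s _ => ?_
    rw [Real.norm_eq_abs, abs_of_nonneg (sq_nonneg _), div_mul_eq_mul_div,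
      le_div_iff₀ (by positivity)]
    simp only [hD]
    nlinarith [sq_nonneg ((1 - c0) * A s - 2 * c1 * η s)]
  refine m.trans ?_
  rw [intervalIntegral.integral_const_mul, intervalIntegral.integral_add (hDL.sq' le_rfl hT)
    ((hη.sq' le_rfl hT).const_mul _), intervalIntegral.integral_const_mul]
  have e1 := hEK T hT
  have e2 := hηK T hT
  gcongr

end DelaySolution

/-! ### Damped trajectories are governed by the delay equation -/

/-- A finite energy trajectory of the wave equation with the damped boundary condition at `0` and
`y(1,t) = 0`. -/
structure DampedTrajectory (c0 c1 : ℝ) (x : ℝ → State) : Prop where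
  traj : IsTrajectory x
  left : WaveDampedLeft c0 c1 x
  right : ∀ t, 0 ≤ t → (x t).pos.right = 0

lemma IsTrajectory.integral_vel {x : ℝ → State} (hx : IsTrajectory x) {t : ℝ} (ht : 0 ≤ t) :
    ∫ s in (0 : ℝ)..t, (x s).vel = (x t).pos.fn - (x 0).pos.fn := by
  have hv : ContinuousOn (fun s => (x s).vel) (Icc 0 t) :=
    (continuousOn_vel hx.cont).mono Icc_subset_Ici_self
  refine intervalIntegral.integral_eq_sub_of_hasDeriv_right_of_le ht
    (f := fun s => (x s).pos.fn) ?_ (fun s hs => ?_) (hv.intervalIntegrable_of_Icc ht)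
  · exact ((H1.continuous_fn.comp State.continuous_pos).comp_continuousOn hx.cont).mono
      Icc_subset_Ici_self
  · exact (hx.deriv s hs.1.le).mono fun r hr => hs.1.le.trans (le_of_lt hr)

/-- The Riemann invariants of a state `(y, y_t)` at time `t` are `y_t + y_x = A(t + ·)` and
`y_x - y_t = A(t + 2 - ·)`; the second is the first after reflection at `x = 1`. -/
def HasInvariant (A : ℝ → ℝ) (t : ℝ) (y : State) : Prop :=
  (∀ᵐ ξ ∂(volume.restrict (Ioo (0 : ℝ) 1)), (y.vel + y.pos.dx) ξ = A (t + ξ)) ∧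
    ∀ᵐ ξ ∂(volume.restrict (Ioo (0 : ℝ) 1)), (y.pos.dx - y.vel) ξ = A (t + 2 - ξ)

lemma L2.intervalIntegrable_sq (g : L2) : IntervalIntegrable (fun s => g s ^ 2) volume 0 1 := by
  rw [intervalIntegrable_iff_integrableOn_Ioo_of_le zero_le_one]
  exact (Lp.memLp g).integrable_sq

lemma LocL2.of_unit_intervals {A : ℝ → ℝ} (hm : Measurable A)
    (h : ∀ n : ℕ, IntervalIntegrable (fun ξ => A (n + ξ) ^ 2) volume 0 1) : LocL2 A where
  meas := hm.aestronglyMeasurable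
  sq T hT := by
    have hn : ∀ n : ℕ, IntervalIntegrable (fun s => A s ^ 2) volume 0 n := fun n => by
      induction n with
      | zero => simp
      | succ n ih =>
        refine ih.trans ?_
        have e := (h n).comp_sub_right n
        simp only [zero_add, add_sub_cancel, add_comm (1 : ℝ)] at e
        exact_mod_cast e
    obtain ⟨n, hn'⟩ := exists_nat_ge T
    refine (hn n).mono_set ?_
    rw [uIcc_of_le hT, uIcc_of_le n.cast_nonneg]
    exact Icc_subset_Icc_right hn'

/-- A representative of `g` by the derivative of its primitive, defined everywhere. -/
lemma ae_eq_deriv {g : L2} {f : ℝ → ℝ} (h : ∀ ξ ∈ Icc (0 : ℝ) 1, f ξ = f 0 + L2.prim ξ g) :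
    ∀ᵐ ξ ∂(volume.restrict (Ioo (0 : ℝ) 1)), g ξ = deriv f ξ := by
  refine (ae_restrict_iff' measurableSet_Ioo).2 ?_
  filter_upwards [(g.intervalIntegrable (x := 1) (by simp)).ae_hasDerivAt_integral] with ξ hξ hm
  have hd := hξ (by rw [uIcc_of_le zero_le_one]; exact Ioo_subset_Icc_self hm) 0 left_mem_uIcc
  refine (HasDerivAt.deriv ((hd.const_add (f 0)).congr_of_eventuallyEq ?_)).symm
  filter_upwards [Icc_mem_nhds hm.1 hm.2] with y hy
  rw [h y hy, L2.prim_apply hy]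

lemma continuousOn_prim {h : ℝ → L2} (hc : ContinuousOn h (Ici 0)) :
    ContinuousOn (fun q : ℝ × ℝ => L2.prim q.2 (h q.1)) (Ici (0 : ℝ) ×ˢ Icc (0 : ℝ) 1) := by
  have hp : ContinuousOn (fun q : ℝ × ℝ => (q.2, h q.1)) (Ici (0 : ℝ) ×ˢ Icc (0 : ℝ) 1) :=
    continuousOn_snd.prodMk (hc.comp continuousOn_fst fun _ hq => hq.1)
  have := Continuous.comp_continuousOn (g := fun q : ℝ × L2 => L2.prim q.1 q.2)
    L2.continuous_prim hp
  exact this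

/-- `y_t = θ_x` for the displacement `y` and its conjugate `θ = P + ∫₀ˣ y_t`, integrated over
`(0,t) × (0,ξ)`. -/
lemma integral_vel_eq {x : ℝ → State} (hx : IsTrajectory x) {t ξ : ℝ} (ht : 0 ≤ t)
    (hξ : ξ ∈ Icc (0 : ℝ) 1) :
    (∫ r in (0 : ℝ)..ξ, ((x t).pos.left + L2.prim r (x t).pos.dx))
      - (∫ r in (0 : ℝ)..ξ, ((x 0).pos.left + L2.prim r (x 0).pos.dx))
      = ∫ s in (0 : ℝ)..t, L2.prim ξ (x s).vel := by
  rw [← isPrimitive_iff.1 (x t).pos.left_spec ξ hξ, ← isPrimitive_iff.1 (x 0).pos.left_spec ξ hξ,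
    integral_prim ht ((continuousOn_vel hx.cont).mono Icc_subset_Ici_self), hx.integral_vel ht,
    map_sub]

/-- `θ_t = y_x`, integrated over `(0,t) × (0,ξ)`. -/
lemma integral_dx_eq {x : ℝ → State} (hx : ContinuousOn x (Ici 0)) {P : ℝ → ℝ} (hP : WaveLeft x P)
    (hP0 : P 0 = 0) {t ξ : ℝ} (ht : 0 ≤ t) (hξ : ξ ∈ Icc (0 : ℝ) 1) :
    (∫ r in (0 : ℝ)..ξ, (P t + L2.prim r (x t).vel))
      - (∫ r in (0 : ℝ)..ξ, (P 0 + L2.prim r (x 0).vel))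
      = ∫ s in (0 : ℝ)..t, L2.prim ξ (x s).pos.dx := by
  have hc : ∀ (c : ℝ) (g : L2), IntervalIntegrable (fun r => c + L2.prim r g) volume 0 ξ :=
    fun c g => (continuous_const.add
      (L2.continuous_prim.comp (continuous_id.prodMk continuous_const))).intervalIntegrable _ _
  rw [integral_prim ht ((continuousOn_dx hx).mono Icc_subset_Ici_self), ← intDx,
    isPrimitive_iff.1 ((waveLeft_iff hx).1 hP t ht) ξ hξ,
    ← intervalIntegral.integral_sub (hc _ _) (hc _ _)]
  congr 1; ext r
  rw [map_sub, hP0]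
  ring

/-- Existence of the Riemann invariant of a damped trajectory, by d'Alembert's formula for `y` and
its conjugate `θ(x,t) = ∫₀ᵗ y_x(0,s) ds + ∫₀ˣ y_t(ξ,t) dξ`. -/
lemma DampedTrajectory.exists_delaySolution {c0 c1 : ℝ} {x : ℝ → State}
    (h : DampedTrajectory c0 c1 x) (h1 : c0 < 1) :
    ∃ A, DelaySolution c0 c1 A (fun t => (x t).pos.left) ∧ ∀ t, 0 ≤ t → HasInvariant A t (x t) := by
  have hX : 1 - c0 ≠ 0 := by linarith
  set l : ℝ → ℝ := fun t => (x t).pos.left with hl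
  have hlc : ContinuousOn l (Ici 0) := continuousOn_left h.traj.cont
  have hlL : LocL2 l := .of_continuousOn hlc
  set P : ℝ → ℝ := fun t => c1 / (1 - c0) * (∫ s in (0 : ℝ)..t, l s)
    + c0 / (1 - c0) * (l t - l 0) with hP
  have hw : WaveLeft x P := h.left
  have hP0 : P 0 = 0 := by simp [hP]
  have hPc : ContinuousOn P (Ici 0) := by
    have : ContinuousOn (fun t => ∫ s in (0 : ℝ)..t, l s) (Ici 0) :=
      hlL.continuousOn_of_primitive fun t _ => by simp
    exact (continuousOn_const.mul this).add (continuousOn_const.mul (hlc.sub continuousOn_const))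
  set Y : ℝ → ℝ → ℝ := fun t ξ => l t + L2.prim ξ (x t).pos.dx with hY
  set Θ : ℝ → ℝ → ℝ := fun t ξ => P t + L2.prim ξ (x t).vel with hΘ
  -- the primitive of the invariant `A`
  set M : ℝ → ℝ := fun s => Y s 0 + Θ s 0 with hM
  have hMe : ∀ s, M s = l s + P s := fun s => by simp [hM, hY, hΘ, L2.prim_zero]
  have key : ∀ {t ξ : ℝ}, 0 ≤ t → ξ ∈ Icc (0 : ℝ) 1 →
      Y t ξ + Θ t ξ = M (t + ξ) ∧ Y t ξ - Θ t ξ = -M (t + 2 - ξ) := by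
    refine fun {t ξ} ht hξ => dAlembert ?_ ?_ ?_ ?_ ?_ ht hξ
    · exact (hlc.comp continuousOn_fst fun _ hq => hq.1).add
        (continuousOn_prim (continuousOn_dx h.traj.cont))
    · exact (hPc.comp continuousOn_fst fun _ hq => hq.1).add
        (continuousOn_prim (continuousOn_vel h.traj.cont))
    · intro t ht ξ hξ
      simpa only [hΘ, L2.prim_zero, add_zero, add_sub_cancel_left] using
        integral_vel_eq h.traj ht hξ
    · intro t ht ξ hξ
      simpa only [hY, L2.prim_zero, add_zero, add_sub_cancel_left] using
        integral_dx_eq h.traj.cont hw hP0 ht hξ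
    · intro t ht
      rw [← h.right t ht, H1.right_eq]
  have k1 : ∀ {t}, 0 ≤ t → ∀ ξ ∈ Icc (0 : ℝ) 1,
      M (t + ξ) = M t + L2.prim ξ ((x t).vel + (x t).pos.dx) := fun {t} ht ξ hξ => by
    rw [← (key ht hξ).1, hMe, map_add]
    simp only [hY, hΘ]; ring
  have k2 : ∀ {t}, 0 ≤ t → ∀ ξ ∈ Icc (0 : ℝ) 1,
      -M (t + 2 - ξ) = -M (t + 2) + L2.prim ξ ((x t).pos.dx - (x t).vel) := fun {t} ht ξ hξ => by
    have e := (key ht (left_mem_Icc.2 zero_le_one)).2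
    rw [sub_zero] at e
    rw [← (key ht hξ).2, ← e, map_sub]
    simp only [hY, hΘ, L2.prim_zero]; ring
  have hinv : ∀ t, 0 ≤ t → HasInvariant (deriv M) t (x t) := fun t ht => by
    constructor
    · filter_upwards [ae_eq_deriv (f := fun ξ => M (t + ξ))
        (fun ξ hξ => by rw [k1 ht ξ hξ, add_zero])] with ξ hξ
      rw [hξ, deriv_comp_const_add]
    · filter_upwards [ae_eq_deriv (f := fun ξ => -M (t + 2 - ξ))
        (fun ξ hξ => by rw [k2 ht ξ hξ, sub_zero])] with ξ hξ
      rw [hξ, deriv.fun_neg, deriv_comp_const_sub, neg_neg]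
  have hA : LocL2 (deriv M) := .of_unit_intervals (measurable_deriv M) fun n => by
    refine ((x n).vel + (x n).pos.dx : L2).intervalIntegrable_sq.congr_ae ?_
    rw [uIoc_of_le zero_le_one, ← Measure.restrict_congr_set Ioo_ae_eq_Ioc]
    filter_upwards [(hinv n n.cast_nonneg).1] with ξ hξ
    rw [hξ]
  have hint : ∀ {t}, 0 ≤ t → ∀ ξ ∈ Icc (0 : ℝ) 1,
      M (t + ξ) = M t + ∫ s in t..t + ξ, deriv M s := fun {t} ht ξ hξ => by
    rw [k1 ht ξ hξ, L2.prim_congr hξ (hinv t ht).1, intervalIntegral.integral_comp_add_left,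
      add_zero]
  have hN : ∀ n : ℕ, M n = M 0 + ∫ s in (0 : ℝ)..n, deriv M s := fun n => by
    induction n with
    | zero => simp
    | succ n ih =>
      have n0 : (0 : ℝ) ≤ n := n.cast_nonneg
      rw [Nat.cast_succ, hint n0 1 (by simp), ih, ← intervalIntegral.integral_add_adjacent_intervals
        (hA.intervalIntegrable le_rfl n0) (hA.intervalIntegrable n0 (by linarith : 0 ≤ (n : ℝ) + 1))]
      ring
  have hMi : ∀ t, 0 ≤ t → M t = M 0 + ∫ s in (0 : ℝ)..t, deriv M s := fun t ht => by
    have n0 : (0 : ℝ) ≤ ⌊t⌋₊ := Nat.cast_nonneg _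
    have e := hint n0 (t - ⌊t⌋₊) ⟨sub_nonneg.2 (Nat.floor_le ht), by
      linarith [Nat.lt_floor_add_one t]⟩
    rw [add_sub_cancel] at e
    rw [e, hN, ← intervalIntegral.integral_add_adjacent_intervals
        (hA.intervalIntegrable le_rfl n0) (hA.intervalIntegrable n0 ht)]
    ring
  refine ⟨deriv M, ⟨hA, fun t ht => ?_, fun t ht => ?_⟩, hinv⟩
  · have e1 := (key ht (left_mem_Icc.2 zero_le_one)).1
    have e2 := (key ht (left_mem_Icc.2 zero_le_one)).2
    have t2 : 0 ≤ t + 2 := by linarith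
    rw [← intervalIntegral.integral_interval_sub_left (hA.intervalIntegrable le_rfl t2)
      (hA.intervalIntegrable le_rfl ht)]
    have e3 := hMi t ht
    have e4 := hMi _ t2
    simp only [hY, hΘ, L2.prim_zero, add_zero, sub_zero] at e1 e2
    linarith
  · have e0 := hMi t ht
    have d0 := hMe 0
    rw [hP0, add_zero] at d0
    rw [hMe t, d0] at e0
    have e1 : (1 - c0) * P t = c1 * (∫ s in (0 : ℝ)..t, l s) + c0 * (l t - l 0) := by
      simp only [hP]; field_simp
    rw [intervalIntegral.integral_sub ((hA.intervalIntegrable le_rfl ht).const_mul _)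
      ((hlL.intervalIntegrable le_rfl ht).const_mul _), intervalIntegral.integral_const_mul,
      intervalIntegral.integral_const_mul]
    change l t = l 0 + _
    linear_combination (1 - c0) * e0 - e1

/-- The energy of a state is carried by the invariant on one period `(t, t + 2)`. -/
lemma HasInvariant.norm_sq {A : ℝ → ℝ} (hA : LocL2 A) {t : ℝ} (ht : 0 ≤ t) {y : State}
    (h : HasInvariant A t y) :
    ‖y.pos.dx‖ ^ 2 + ‖y.vel‖ ^ 2 = (∫ s in t..t + 2, A s ^ 2) / 2 := by
  have p := parallelogram_law_with_norm ℝ y.pos.dx y.vel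
  have cong : ∀ {g : L2} {f : ℝ → ℝ}, (∀ᵐ ξ ∂(volume.restrict (Ioo (0 : ℝ) 1)), g ξ = f ξ) →
      ‖g‖ ^ 2 = ∫ ξ in (0 : ℝ)..1, f ξ ^ 2 := fun {g f} hg => by
    rw [L2.norm_sq_eq, intervalIntegral.integral_of_le zero_le_one, integral_Ioc_eq_integral_Ioo,
      intervalIntegral.integral_of_le zero_le_one, integral_Ioc_eq_integral_Ioo]
    refine integral_congr_ae ?_
    filter_upwards [hg] with ξ hξ
    rw [hξ]
  have e1 := cong h.1
  have e2 := cong h.2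
  rw [intervalIntegral.integral_comp_add_left (fun s => A s ^ 2), add_zero] at e1
  rw [intervalIntegral.integral_comp_sub_left (fun s => A s ^ 2), sub_zero,
    show t + 2 - 1 = t + 1 by ring] at e2
  rw [← intervalIntegral.integral_add_adjacent_intervals
    (hA.sq' ht (by linarith : 0 ≤ t + 1)) (hA.sq' (by linarith : 0 ≤ t + 1)
    (by linarith : 0 ≤ t + 2)), ← e1, ← e2, add_comm y.vel]
  linarith

/-- The flux at the reflecting end is the invariant that arrives there, `y_x(1,t) = A(t + 1)`. -/
lemma hasRightFlux_of_invariant {c0 c1 : ℝ} {x : ℝ → State} (hx : ContinuousOn x (Ici 0))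
    (hw : WaveDampedLeft c0 c1 x) (h1 : c0 < 1) {A : ℝ → ℝ}
    (hA : DelaySolution c0 c1 A (fun t => (x t).pos.left))
    (hi : ∀ t, 0 ≤ t → HasInvariant A t (x t)) : HasRightFlux x (fun t => A (t + 1)) := by
  have hAi : ∀ {a b : ℝ}, 0 ≤ a → 0 ≤ b → IntervalIntegrable A volume a b :=
    fun ha hb => hA.locL2.intervalIntegrable ha hb
  constructor
  · refine (locallyIntegrableOn_iff isClosed_Ici.isLocallyClosed).2 fun k hk hc => ?_
    obtain ⟨T, hT⟩ := hc.bddAbove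
    have hT' : k ⊆ Icc 0 (max T 0) := fun s hs => ⟨hk hs, (hT hs).trans (le_max_left _ _)⟩
    refine IntegrableOn.mono_set ?_ hT'
    rw [← intervalIntegrable_iff_integrableOn_Icc_of_le (le_max_right _ _)]
    have := (hAi (a := 0 + 1) (b := max T 0 + 1) (by norm_num)
      (by linarith [le_max_right T 0])).comp_add_right 1
    simpa using this
  · refine waveRight_of_waveLeft hx hw fun t ht => ?_
    have hv : ∀ t, 0 ≤ t → 2 * L2.prim 1 (x t).vel
        = 2 * (∫ s in (0 : ℝ)..t + 1, A s) - (∫ s in (0 : ℝ)..t, A s)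
          - ∫ s in (0 : ℝ)..t + 2, A s := fun t ht => by
      have h11 : (1 : ℝ) ∈ Icc (0 : ℝ) 1 := by simp
      have i1 := L2.prim_congr h11 (hi t ht).1
      have i2 := L2.prim_congr h11 (hi t ht).2
      rw [intervalIntegral.integral_comp_add_left, add_zero, map_add,
        ← intervalIntegral.integral_interval_sub_left (hAi le_rfl (by linarith : 0 ≤ t + 1))
          (hAi le_rfl ht)] at i1
      rw [intervalIntegral.integral_comp_sub_left, sub_zero, show t + 2 - 1 = t + 1 by ring,
        map_sub, ← intervalIntegral.integral_interval_sub_left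
          (hAi le_rfl (by linarith : 0 ≤ t + 2)) (hAi le_rfl (by linarith : 0 ≤ t + 1))] at i2
      linarith
    have et := hA.trace t ht
    have e0 := hA.trace 0 le_rfl
    have v0 := hv 0 le_rfl
    have vt := hv t ht
    rw [← intervalIntegral.integral_interval_sub_left (hAi le_rfl (by linarith : 0 ≤ t + 2))
          (hAi le_rfl ht)] at et
    rw [zero_add] at e0 v0
    rw [zero_add, intervalIntegral.integral_same] at v0
    rw [intervalIntegral.integral_comp_add_right, zero_add,
      ← intervalIntegral.integral_interval_sub_left (hAi le_rfl (by linarith : 0 ≤ t + 1))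
          (hAi le_rfl zero_le_one), map_sub]
    rw [hA.flux_eq h1 ht]
    linarith

lemma DampedTrajectory.hasRightFlux {c0 c1 : ℝ} {x : ℝ → State} (h : DampedTrajectory c0 c1 x)
    (h0 : 0 < c0) (h1 : c0 < 1) (hc1 : 0 < c1) :
    ∃ g, HasRightFlux x g ∧ MemLp g 2 (volume.restrict (Ioi 0)) := by
  obtain ⟨A, hA, hi⟩ := h.exists_delaySolution h1
  refine ⟨_, hasRightFlux_of_invariant h.traj.cont h.left h1 hA hi, ?_⟩
  have hm := hA.memLp h0 h1 hc1
  have hmp := (measurePreserving_add_right volume (1 : ℝ)).restrict_preimage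
    (measurableSet_Ioi (a := (1 : ℝ)))
  have hs : (fun s : ℝ => s + 1) ⁻¹' Ioi 1 = Ioi 0 := by ext s; simp
  rw [hs] at hmp
  exact (hm.mono_measure (Measure.restrict_mono (Ioi_subset_Ioi zero_le_one) le_rfl)).comp_measurePreserving
    hmp

lemma H1.abs_left_le {y : H1} (hy : y.right = 0) : |y.left| ≤ ‖y.dx‖ := by
  rw [H1.right_eq] at hy
  rw [eq_neg_of_add_eq_zero_left hy, abs_neg]
  exact L2.abs_prim_le _ _

/-- Poincaré's inequality. -/
lemma H1.norm_fn_le {y : H1} (hy : y.right = 0) : ‖y.fn‖ ^ 2 ≤ (2 * ‖y.dx‖) ^ 2 := by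
  rw [L2.norm_sq_eq]
  have hb : ∀ᵐ s ∂(volume.restrict (Ioo (0 : ℝ) 1)), y.fn s ^ 2 ≤ (2 * ‖y.dx‖) ^ 2 := by
    filter_upwards [y.left_spec.prim] with s hs
    refine sq_le_sq' ?_ ?_ <;> rw [hs] <;>
      linarith [abs_le.1 (H1.abs_left_le hy), abs_le.1 (L2.abs_prim_le s y.dx)]
  rw [intervalIntegral.integral_of_le zero_le_one, integral_Ioc_eq_integral_Ioo]
  refine (integral_mono_ae (Lp.memLp y.fn).integrable_sq (integrable_const _) hb).trans ?_
  simp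

lemma State.norm_sq (y : State) : ‖y‖ ^ 2 = ‖y.pos.fn‖ ^ 2 + ‖y.pos.dx‖ ^ 2 + ‖y.vel‖ ^ 2 := by
  rw [← H1.norm_sq]
  exact WithLp.prod_norm_sq_eq_of_L2 y

/-- Uniform boundedness in the energy norm. -/
lemma DampedTrajectory.norm_le {c0 c1 : ℝ} {x : ℝ → State} (h : DampedTrajectory c0 c1 x)
    (h0 : 0 < c0) (h1 : c0 < 1) (hc1 : 0 < c1) {t : ℝ} (ht : 0 ≤ t) :
    ‖x t‖ ≤ √(5 * (1 + c1 / (1 - c0))) * ‖x 0‖ := by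
  have hX : 0 < 1 - c0 := by linarith
  obtain ⟨A, hA, hi⟩ := h.exists_delaySolution h1
  have n0 := (hi 0 le_rfl).norm_sq hA.locL2 le_rfl
  have nt := (hi t ht).norm_sq hA.locL2 ht
  have e := hA.energy h1 ht
  have p1 : 0 ≤ 2 * c1 / (1 - c0) * (x t).pos.left ^ 2 := by positivity
  have p2 : 0 ≤ 4 * c0 / (1 - c0)
      * ∫ s in (0 : ℝ)..t, ((1 - c0) * A s - c1 * (x s).pos.left) ^ 2 :=
    mul_nonneg (by positivity) (intervalIntegral.integral_nonneg ht fun _ _ => sq_nonneg _)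
  have l0 : (x 0).pos.left ^ 2 ≤ ‖(x 0).pos.dx‖ ^ 2 := by
    rw [← sq_abs]
    gcongr
    exact H1.abs_left_le (h.right 0 le_rfl)
  have l1 : 2 * c1 / (1 - c0) * (x 0).pos.left ^ 2 ≤ 2 * c1 / (1 - c0) * ‖(x 0).pos.dx‖ ^ 2 := by
    gcongr
  have f := H1.norm_fn_le (h.right t ht)
  have s0 := State.norm_sq (x 0)
  have st := State.norm_sq (x t)
  rw [zero_add] at n0
  refine abs_le_of_sq_le_sq ?_ (by positivity) |> (le_abs_self _).trans
  rw [mul_pow, Real.sq_sqrt (by positivity)]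
  have a : ‖x t‖ ^ 2 ≤ 5 * (‖(x t).pos.dx‖ ^ 2 + ‖(x t).vel‖ ^ 2) := by
    nlinarith [sq_nonneg ‖(x t).vel‖]
  have b : ‖(x t).pos.dx‖ ^ 2 + ‖(x t).vel‖ ^ 2 ≤ (1 + c1 / (1 - c0)) * ‖x 0‖ ^ 2 := by
    have c : 2 * c1 / (1 - c0) = 2 * (c1 / (1 - c0)) := by ring
    have q : 0 ≤ c1 / (1 - c0) := by positivity
    rw [c] at e l1 p1
    have m : c1 / (1 - c0) * ‖(x 0).pos.dx‖ ^ 2 ≤ c1 / (1 - c0) * ‖x 0‖ ^ 2 :=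
      mul_le_mul_of_nonneg_left (by linarith [sq_nonneg ‖(x 0).vel‖, sq_nonneg ‖(x 0).pos.fn‖]) q
    rw [add_mul, one_mul]
    linarith [sq_nonneg ‖(x 0).pos.fn‖]
  linarith

/-! ### Existence for the delay equation, by the method of steps -/

/-- `f` on `(0,a)`, followed by `g` started at time `a`. -/
lemma LocL2.glue {f g : ℝ → ℝ} {a : ℝ} (ha : 0 ≤ a)
    (hfm : AEStronglyMeasurable f (volume.restrict (Ioo 0 a)))
    (hf : IntervalIntegrable (fun s => f s ^ 2) volume 0 a) (hg : LocL2 g) :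
    LocL2 (fun t => if t < a then f t else g (t - a)) where
  meas := by
    have hu : Ioi (0 : ℝ) ⊆ Ioo 0 a ∪ Ici a := fun s hs => by
      rcases lt_or_ge s a with h | h
      · exact Or.inl ⟨hs, h⟩
      · exact Or.inr h
    refine AEStronglyMeasurable.mono_measure ?_ (Measure.restrict_mono hu le_rfl)
    rw [aestronglyMeasurable_union_iff]
    constructor
    · refine hfm.congr ?_
      filter_upwards [ae_restrict_mem measurableSet_Ioo] with s hs
      rw [if_pos hs.2]
    · have hmp := (measurePreserving_sub_right volume a).restrict_preimage
        (measurableSet_Ioi (a := (0 : ℝ)))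
      have hs : (fun s : ℝ => s - a) ⁻¹' Ioi 0 = Ioi a := by ext s; simp
      rw [hs] at hmp
      rw [Measure.restrict_congr_set Ioi_ae_eq_Ici.symm]
      refine (hg.meas.comp_measurePreserving hmp).congr ?_
      filter_upwards [ae_restrict_mem measurableSet_Ioi] with s hs
      rw [if_neg (not_lt.2 (le_of_lt hs)), Function.comp_apply]
  sq T hT := by
    have h1 : IntervalIntegrable (fun t => (if t < a then f t else g (t - a)) ^ 2) volume 0 a := by
      refine hf.congr_ae ?_
      rw [uIoc_of_le ha, ← Measure.restrict_congr_set Ioo_ae_eq_Ioc]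
      filter_upwards [ae_restrict_mem measurableSet_Ioo] with s hs
      rw [if_pos hs.2]
    have h2 : IntervalIntegrable (fun t => (if t < a then f t else g (t - a)) ^ 2)
        volume a (T + a) := by
      have := (hg.sq T hT).comp_sub_right a
      rw [zero_add] at this
      refine this.congr fun s hs => ?_
      rw [uIoc_of_le (by linarith)] at hs
      simp only [if_neg (not_lt.2 hs.1.le)]
    refine (h1.trans h2).mono_set ?_
    rw [uIcc_of_le hT, uIcc_of_le (by linarith)]
    exact Icc_subset_Icc_right (by linarith)

lemma LocL2.continuous_mul {f g : ℝ → ℝ} (hf : Continuous f) (hg : LocL2 g) :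
    LocL2 (fun s => f s * g s) where
  meas := hf.aestronglyMeasurable.mul hg.meas
  sq T hT := by
    simp only [mul_pow]
    exact (hg.sq T hT).continuousOn_mul (hf.pow 2).continuousOn

/-- The displacement at `x = 0` driven by the incoming invariant `A`: the solution of
`η' = (1 - c₀) A - c₁ η` with `η(0) = e`. -/
noncomputable def driven (c0 c1 e : ℝ) (A : ℝ → ℝ) (t : ℝ) : ℝ :=
  Real.exp (-c1 * t) * (e + ∫ s in (0 : ℝ)..t, (1 - c0) * Real.exp (c1 * s) * A s)

lemma LocL2.driven_integrand {A : ℝ → ℝ} (hA : LocL2 A) (c0 c1 : ℝ) :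
    LocL2 (fun s => (1 - c0) * Real.exp (c1 * s) * A s) :=
  hA.continuous_mul (by fun_prop)

lemma continuousOn_driven {c0 c1 e : ℝ} {A : ℝ → ℝ} (hA : LocL2 A) :
    ContinuousOn (driven c0 c1 e A) (Ici 0) := by
  have h : ContinuousOn (fun t => e + ∫ s in (0 : ℝ)..t, (1 - c0) * Real.exp (c1 * s) * A s)
      (Ici 0) := continuousOn_const.add
    ((hA.driven_integrand c0 c1).continuousOn_of_primitive fun t _ => by simp)
  exact (by fun_prop : ContinuousOn (fun t => Real.exp (-c1 * t)) (Ici 0)).mul h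

lemma driven_zero {c0 c1 e : ℝ} {A : ℝ → ℝ} : driven c0 c1 e A 0 = e := by simp [driven]

lemma driven_ode {c0 c1 e : ℝ} {A : ℝ → ℝ} (hA : LocL2 A) {t : ℝ} (ht : 0 ≤ t) :
    driven c0 c1 e A t = e + ∫ s in (0 : ℝ)..t, ((1 - c0) * A s - c1 * driven c0 c1 e A s) := by
  have hE : Continuous (fun s => -c1 * Real.exp (-c1 * s)) := by fun_prop
  have hd : ∀ s, HasDerivAt (fun s => Real.exp (-c1 * s)) (-c1 * Real.exp (-c1 * s)) s := fun s => by
    have := ((hasDerivAt_id s).const_mul (-c1)).exp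
    simpa [mul_comm] using this
  have e1 := integral_mul_add_mul_primitive (f := fun s => Real.exp (-c1 * s))
    (g := fun t => e + ∫ s in (0 : ℝ)..t, (1 - c0) * Real.exp (c1 * s) * A s) ht
    (hE.intervalIntegrable 0 t) ((hA.driven_integrand c0 c1).intervalIntegrable le_rfl ht)
    (fun x _ => by
      rw [intervalIntegral.integral_eq_sub_of_hasDerivAt (fun s _ => hd s)
        (hE.intervalIntegrable _ _)]
      ring) (fun x _ => by simp)
  simp only [mul_zero, Real.exp_zero, intervalIntegral.integral_same, add_zero, one_mul] at e1
  have e2 : ∀ s, Real.exp (-c1 * s) * ((1 - c0) * Real.exp (c1 * s) * A s) = (1 - c0) * A s :=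
    fun s => by
      have : Real.exp (-c1 * s) * Real.exp (c1 * s) = 1 := by
        rw [← Real.exp_add]; simp
      linear_combination ((1 - c0) * A s) * this
  rw [driven, ← sub_eq_iff_eq_add', ← e1]
  refine intervalIntegral.integral_congr fun s _ => ?_
  simp only [driven]
  rw [e2]
  ring

/-- One step of the method of steps: keep `A₀` on `(-∞,2)` and use the reflection law
`A(t + 2) = A(t) - 2 η'(t)`, in which `η' = (1 - c₀) A - c₁ η`, afterwards. -/
noncomputable def delayStep (c0 c1 e : ℝ) (A₀ A : ℝ → ℝ) (t : ℝ) : ℝ :=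
  if t < 2 then A₀ t else (2 * c0 - 1) * A (t - 2) + 2 * c1 * driven c0 c1 e A (t - 2)

lemma delayStep_congr {c0 c1 e : ℝ} {A₀ A B : ℝ → ℝ} {t : ℝ} (h : ∀ s ≤ t - 2, A s = B s) :
    delayStep c0 c1 e A₀ A t = delayStep c0 c1 e A₀ B t := by
  by_cases ht : t < 2
  · simp only [delayStep, if_pos ht]
  simp only [delayStep, if_neg ht, driven]
  rw [h _ le_rfl, intervalIntegral.integral_congr (g := fun s =>
    (1 - c0) * Real.exp (c1 * s) * B s) fun s hs => ?_]
  rw [uIcc_of_le (by linarith)] at hs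
  simp only [h s hs.2]

lemma LocL2.delayStep {c0 c1 e : ℝ} {A₀ A : ℝ → ℝ} (h₀ : LocL2 A₀) (hA : LocL2 A) :
    LocL2 (delayStep c0 c1 e A₀ A) :=
  LocL2.glue zero_le_two (h₀.meas.mono_measure (Measure.restrict_mono Ioo_subset_Ioi_self le_rfl))
    (h₀.sq 2 zero_le_two)
    ((hA.const_mul _).add ((LocL2.of_continuousOn (continuousOn_driven hA)).const_mul _))

lemma LocL2.of_eqOn {A : ℝ → ℝ} (h : ∀ n : ℕ, ∃ B, LocL2 B ∧ ∀ s < (n : ℝ), A s = B s) :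
    LocL2 A where
  meas := by
    have hu : Ioi (0 : ℝ) ⊆ ⋃ n : ℕ, Ioo (0 : ℝ) n := fun s hs => by
      obtain ⟨n, hn⟩ := exists_nat_gt s
      exact mem_iUnion.2 ⟨n, hs, hn⟩
    refine AEStronglyMeasurable.mono_measure ?_ (Measure.restrict_mono hu le_rfl)
    rw [aestronglyMeasurable_iUnion_iff]
    intro n
    obtain ⟨B, hB, e⟩ := h n
    refine (hB.meas.mono_measure (Measure.restrict_mono Ioo_subset_Ioi_self le_rfl)).congr ?_
    filter_upwards [ae_restrict_mem measurableSet_Ioo] with s hs using (e s hs.2).symm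
  sq T hT := by
    obtain ⟨n, hn⟩ := exists_nat_gt T
    obtain ⟨B, hB, e⟩ := h n
    refine (hB.sq T hT).congr fun s hs => ?_
    rw [uIoc_of_le hT] at hs
    rw [e s (hs.2.trans_lt hn)]

/-- The step depends on its argument up to time `t - 2` only, so the iterates are eventually
constant on every bounded interval and their limit is a fixed point. -/
lemma exists_delayStep_fixed (c0 c1 e : ℝ) {A₀ : ℝ → ℝ} (h₀ : LocL2 A₀) :
    ∃ A, LocL2 A ∧ ∀ t, A t = delayStep c0 c1 e A₀ A t := by
  let As : ℕ → ℝ → ℝ := fun n => Nat.rec A₀ (fun _ B => delayStep c0 c1 e A₀ B) n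
  have hs : ∀ n, As (n + 1) = delayStep c0 c1 e A₀ (As n) := fun n => rfl
  have hL : ∀ n, LocL2 (As n) := fun n => by
    induction n with
    | zero => exact h₀
    | succ n ih => rw [hs]; exact h₀.delayStep ih
  have h1 : ∀ n : ℕ, ∀ t < 2 * (n : ℝ) + 2, As (n + 1) t = As n t := fun n => by
    induction n with
    | zero =>
      intro t ht
      simp only [Nat.cast_zero, mul_zero, zero_add] at ht
      rw [hs, delayStep, if_pos ht]
      rfl
    | succ n ih =>
      intro t ht
      change delayStep c0 c1 e A₀ (As (n + 1)) t = delayStep c0 c1 e A₀ (As n) t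
      refine delayStep_congr fun s hs' => ih s ?_
      push_cast at ht
      linarith
  have h2 : ∀ n m : ℕ, n ≤ m → ∀ t < 2 * (n : ℝ) + 2, As m t = As n t := fun n m hnm => by
    induction m, hnm using Nat.le_induction with
    | base => intro t _; rfl
    | succ m hm ih =>
      intro t ht
      have : (n : ℝ) ≤ m := by exact_mod_cast hm
      rw [h1 m t (by linarith), ih t ht]
  have h3 : ∀ n : ℕ, ∀ t < 2 * (n : ℝ) + 2, As ⌊t⌋₊ t = As n t := fun n t ht => by
    rcases le_total n ⌊t⌋₊ with h | h
    · exact h2 _ _ h t ht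
    · have := Nat.lt_floor_add_one t
      have h0 : (0 : ℝ) ≤ (⌊t⌋₊ : ℝ) := Nat.cast_nonneg _
      exact (h2 _ _ h t (by linarith)).symm
  refine ⟨fun t => As ⌊t⌋₊ t, .of_eqOn fun n => ⟨As n, hL n, fun s hs => h3 n s ?_⟩, fun t => ?_⟩
  · have h0 : (0 : ℝ) ≤ n := n.cast_nonneg
    linarith
  · have := Nat.lt_floor_add_one t
    have h0 : (0 : ℝ) ≤ (⌊t⌋₊ : ℝ) := Nat.cast_nonneg _
    change As ⌊t⌋₊ t = _
    rw [← h1 _ t (by linarith), hs]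
    exact delayStep_congr fun s hs' => (h3 _ s (by linarith)).symm

/-- Every `A₀` on `(0,2)` is the initial part of a solution of the delay equation. The trace
relation holds at `t = 0` by the choice of `η(0)`, and it persists because both sides have the same
derivative. -/
lemma exists_delaySolution_of_initial (c0 c1 : ℝ) {A₀ : ℝ → ℝ} (h₀ : LocL2 A₀) :
    ∃ A, (∀ t < 2, A t = A₀ t) ∧
      DelaySolution c0 c1 A (fun t => -(∫ s in t..t + 2, A s) / 2) := by
  set e : ℝ := -(∫ s in (0 : ℝ)..2, A₀ s) / 2 with he
  obtain ⟨A, hA, hfix⟩ := exists_delayStep_fixed c0 c1 e h₀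
  have hA0 : ∀ t < 2, A t = A₀ t := fun t ht => by rw [hfix, delayStep, if_pos ht]
  have hAi : ∀ {a b : ℝ}, 0 ≤ a → 0 ≤ b → IntervalIntegrable A volume a b :=
    fun ha hb => hA.intervalIntegrable ha hb
  have e0 : ∫ s in (0 : ℝ)..2, A s = ∫ s in (0 : ℝ)..2, A₀ s := by
    refine intervalIntegral.integral_congr_ae ?_
    have hne : ∀ᵐ s : ℝ, s ≠ 2 := by simp [ae_iff, measure_singleton]
    filter_upwards [hne] with s hs hm
    rw [uIoc_of_le zero_le_two] at hm
    exact hA0 s (lt_of_le_of_ne hm.2 hs)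
  set H := driven c0 c1 e A with hH
  have hHL : LocL2 H := .of_continuousOn (continuousOn_driven hA)
  have hdel : ∀ t, 0 ≤ t → A (t + 2) = (2 * c0 - 1) * A t + 2 * c1 * H t := fun t ht => by
    rw [hfix, delayStep, if_neg (by linarith), add_sub_cancel_right]
  have hηH : ∀ t, 0 ≤ t → -(∫ s in t..t + 2, A s) / 2 = H t := fun t ht => by
    have t2 : 0 ≤ t + 2 := by linarith
    have i1 : ∫ s in (0 : ℝ)..t, A (s + 2)
        = ∫ s in (0 : ℝ)..t, ((2 * c0 - 1) * A s + 2 * c1 * H s) :=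
      intervalIntegral.integral_congr fun s hs => by
        rw [uIcc_of_le ht] at hs
        exact hdel s hs.1
    have i2 := driven_ode (c0 := c0) (c1 := c1) (e := e) hA ht
    have a1 := (hAi le_rfl ht)
    have a2 := (hHL.intervalIntegrable le_rfl ht)
    rw [intervalIntegral.integral_comp_add_right, zero_add,
      ← intervalIntegral.integral_interval_sub_left (hAi le_rfl t2) (hAi le_rfl zero_le_two), e0,
      intervalIntegral.integral_add (a1.const_mul _) (a2.const_mul _),
      intervalIntegral.integral_const_mul, intervalIntegral.integral_const_mul] at i1
    rw [← hH, intervalIntegral.integral_sub (a1.const_mul _) (a2.const_mul _),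
      intervalIntegral.integral_const_mul, intervalIntegral.integral_const_mul] at i2
    rw [← intervalIntegral.integral_interval_sub_left (hAi le_rfl t2) a1]
    linarith
  refine ⟨A, hA0, hA, fun t _ => rfl, fun t ht => ?_⟩
  rw [hηH t ht, hηH 0 le_rfl, hH, driven_zero, driven_ode hA ht]
  congr 1
  refine intervalIntegral.integral_congr fun s hs => ?_
  rw [uIcc_of_le ht] at hs
  simp only [hηH s hs.1, hH]

/-! ### Existence of damped trajectories -/

/-- Translates and reflected translates of a locally square integrable function depend
continuously on the parameter in `L²(0,1)`. -/
lemma exists_continuousOn_comp {A : ℝ → ℝ} (hA : LocL2 A) {φ : ℝ → C(ℝ, ℝ)} (hφ : Continuous φ)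
    (hmp : ∀ t, MeasurePreserving (φ t) volume volume)
    (hpos : ∀ t, 0 ≤ t → ∀ ξ ∈ Ioo (0 : ℝ) 1, φ t ξ ∈ Ioo 0 (t + 2)) :
    ∃ G : ℝ → L2, ContinuousOn G (Ici 0) ∧
      ∀ t, 0 ≤ t → ∀ᵐ ξ ∂(volume.restrict (Ioo (0 : ℝ) 1)), G t ξ = A (φ t ξ) := by
  have hB : ∀ n : ℕ, MemLp ((Ioo (0 : ℝ) (n + 2)).indicator A) 2 volume := fun n => by
    rw [memLp_indicator_iff_restrict measurableSet_Ioo, memLp_two_iff_integrable_sq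
      (hA.meas.mono_measure (Measure.restrict_mono Ioo_subset_Ioi_self le_rfl))]
    have h0 : (0 : ℝ) ≤ n + 2 := by positivity
    exact (intervalIntegrable_iff_integrableOn_Ioo_of_le h0).1 (hA.sq _ h0)
  let G : ℕ → ℝ → L2 := fun n t =>
    LpToLpRestrictCLM ℝ ℝ ℝ volume 2 (Ioo (0 : ℝ) 1)
      (Lp.compMeasurePreserving (φ t) (hmp t) (hB n).toLp)
  have hGc : ∀ n, Continuous (G n) := fun n =>
    (LpToLpRestrictCLM ℝ ℝ ℝ volume 2 (Ioo (0 : ℝ) 1)).continuous.comp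
      (Continuous.compMeasurePreservingLp continuous_const hφ hmp (by norm_num))
  have hGe : ∀ n : ℕ, ∀ t : ℝ, 0 ≤ t → t ≤ n →
      ∀ᵐ ξ ∂(volume.restrict (Ioo (0 : ℝ) 1)), G n t ξ = A (φ t ξ) := fun n t ht htn => by
    filter_upwards [LpToLpRestrictCLM_coeFn ℝ (Ioo (0 : ℝ) 1)
        (Lp.compMeasurePreserving (φ t) (hmp t) (hB n).toLp),
      ae_restrict_of_ae (Lp.coeFn_compMeasurePreserving (hB n).toLp (hmp t)),
      ae_restrict_of_ae ((hmp t).quasiMeasurePreserving.ae (hB n).coeFn_toLp),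
      ae_restrict_mem measurableSet_Ioo] with ξ e1 e2 e3 hξ
    have hm := hpos t ht ξ hξ
    rw [e1, e2, Function.comp_apply, e3, indicator_of_mem
      (show φ t ξ ∈ Ioo (0 : ℝ) (n + 2) from ⟨hm.1, hm.2.trans_le (by linarith)⟩)]
  have heq : ∀ n m : ℕ, ∀ t : ℝ, 0 ≤ t → t ≤ n → t ≤ m → G n t = G m t := fun n m t ht hn hm =>
    Lp.ext (by filter_upwards [hGe n t ht hn, hGe m t ht hm] with ξ e1 e2; rw [e1, e2])
  refine ⟨fun t => G ⌈t⌉₊ t, fun t ht => ?_, fun t ht => hGe _ t ht (Nat.le_ceil t)⟩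
  have hc : ContinuousWithinAt (G (⌈t⌉₊ + 1)) (Ici 0) t := (hGc _).continuousWithinAt
  have ht1 : t < ((⌈t⌉₊ + 1 : ℕ) : ℝ) := by push_cast; linarith [Nat.le_ceil t]
  refine hc.congr_of_eventuallyEq ?_ (heq _ _ t ht (Nat.le_ceil t) ht1.le)
  filter_upwards [self_mem_nhdsWithin, mem_nhdsWithin_of_mem_nhds (Iio_mem_nhds ht1)] with s h1 h2
  exact heq _ _ s h1 (Nat.le_ceil s) (le_of_lt h2)

lemma H1.ext_of_dx {y y' : H1} (hd : y.dx = y'.dx) (hl : y.left = y'.left) : y = y' := by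
  have hf : y.fn = y'.fn := Lp.ext (by
    filter_upwards [y.left_spec, y'.left_spec] with x e e'
    rw [e, e', hd, hl])
  have h1 : y.1.fst = y'.1.fst := hf
  have h2 : y.1.snd = y'.1.snd := hd
  exact Subtype.ext (WithLp.ofLp_injective 2 (Prod.ext h1 h2))

lemma H1R.ext_of_dx {y y' : H1R} (hd : (y : H1).dx = (y' : H1).dx) : y = y' := by
  refine Subtype.ext (H1.ext_of_dx hd ?_)
  have e : (y : H1).right = 0 := y.2
  have e' : (y' : H1).right = 0 := y'.2
  rw [H1.right_eq] at e e'
  rw [hd] at e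
  linarith

lemma exists_H1R (g : L2) : ∃ y : H1R, (y : H1).dx = g := by
  obtain ⟨φ, hφ, hl⟩ := exists_H1 g (-L2.prim 1 g)
  refine ⟨⟨φ, ?_⟩, hφ⟩
  change φ.right = 0
  rw [H1.right_eq, hφ, hl, neg_add_cancel]

/-- The element `x ↦ -∫ₓ¹ g` of `H¹_R(0,1)` with derivative `g`. -/
noncomputable def H1R.ofDx : L2 →L[ℝ] H1R :=
  LinearMap.mkContinuous
    { toFun := fun g => Classical.choose (exists_H1R g)
      map_add' := fun g g' => H1R.ext_of_dx (by
        change _ = ((Classical.choose (exists_H1R g) : H1R) : H1).dx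
          + ((Classical.choose (exists_H1R g') : H1R) : H1).dx
        simp only [Classical.choose_spec (exists_H1R _)])
      map_smul' := fun c g => H1R.ext_of_dx (by
        change _ = c • ((Classical.choose (exists_H1R g) : H1R) : H1).dx
        simp only [Classical.choose_spec (exists_H1R _)]) } 3 fun g => by
    have hd := Classical.choose_spec (exists_H1R g)
    set y := Classical.choose (exists_H1R g)
    have e := H1.norm_sq (y : H1)
    have hp := H1.norm_fn_le (y := (y : H1)) y.2
    rw [hd] at e hp
    change ‖(y : H1)‖ ≤ 3 * ‖g‖
    exact abs_le_of_sq_le_sq' (by nlinarith [sq_nonneg ‖g‖]) (by positivity) |>.2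

lemma H1R.dx_ofDx (g : L2) : (H1R.ofDx g : H1).dx = g := Classical.choose_spec (exists_H1R g)

lemma State0.continuous_toState : Continuous State0.toState :=
  (WithLp.prod_continuous_toLp 2 H1 L2).comp
    ((continuous_subtype_val.comp (WithLp.continuous_fst (p := 2) (α := H1R) (β := L2))).prodMk
      (WithLp.continuous_snd (p := 2) (α := H1R) (β := L2)))

/-- The fundamental theorem of calculus on `[0,∞)`, one-sided at `0`. -/
lemma hasDerivWithinAt_of_integral {f h : ℝ → L2} (hc : ContinuousOn h (Ici 0))
    (hf : ∀ t, 0 ≤ t → f t - f 0 = ∫ s in (0 : ℝ)..t, h s) {t : ℝ} (ht : 0 ≤ t) :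
    HasDerivWithinAt f (h t) (Ici 0) t := by
  have hc' : Continuous (fun s => h (max s 0)) :=
    hc.comp_continuous (by fun_prop) fun s => le_max_right s 0
  have hd := ((hc'.integral_hasStrictDerivAt 0 t).hasDerivAt.const_add (f 0)).hasDerivWithinAt
    (s := Ici 0)
  rw [max_eq_left ht] at hd
  have e : ∀ s ∈ Ici (0 : ℝ), f s = f 0 + ∫ r in (0 : ℝ)..s, h (max r 0) := fun s hs => by
    rw [intervalIntegral.integral_congr (g := h) fun r hr => ?_, ← hf s hs, add_sub_cancel]
    rw [uIcc_of_le hs] at hr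
    simp only [max_eq_left hr.1]
  exact hd.congr e (e t ht)

lemma DelaySolution.congr {c0 c1 : ℝ} {A η η' : ℝ → ℝ} (h : DelaySolution c0 c1 A η)
    (e : ∀ t, 0 ≤ t → η' t = η t) : DelaySolution c0 c1 A η' where
  locL2 := h.locL2
  trace t ht := by rw [e t ht, h.trace t ht]
  ode t ht := by
    rw [e t ht, e 0 le_rfl, h.ode t ht]
    congr 1
    refine intervalIntegral.integral_congr fun s hs => ?_
    rw [uIcc_of_le ht] at hs
    simp only [e s hs.1]

/-- A curve of states with the Riemann invariants of a solution of the delay equation is a damped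
trajectory. Both evolution equations are checked after integration over `(0,x)` and `(0,t)`, where
they are identities between values of a second primitive of `A`. -/
lemma dampedTrajectory_of_invariant {c0 c1 : ℝ} (h1 : c0 < 1) {A : ℝ → ℝ} {x : ℝ → State}
    (hx : ContinuousOn x (Ici 0)) (hr : ∀ t, 0 ≤ t → (x t).pos.right = 0)
    (hA : DelaySolution c0 c1 A (fun t => -(∫ s in t..t + 2, A s) / 2))
    (hi : ∀ t, 0 ≤ t → HasInvariant A t (x t)) : DampedTrajectory c0 c1 x := by
  have hAi : ∀ {a b : ℝ}, 0 ≤ a → 0 ≤ b → IntervalIntegrable A volume a b :=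
    fun ha hb => hA.locL2.intervalIntegrable ha hb
  -- a continuous primitive of `A`, extended by zero to negative times
  set N : ℝ → ℝ := fun t => ∫ s in (0 : ℝ)..max t 0, A s with hN
  have hNc : Continuous N := by
    have : ContinuousOn (fun t => ∫ s in (0 : ℝ)..t, A s) (Ici 0) :=
      hA.locL2.continuousOn_of_primitive fun t _ => by simp
    exact this.comp_continuous (by fun_prop : Continuous fun t : ℝ => max t 0)
      fun s => le_max_right s 0
  have hNe : ∀ {t : ℝ}, 0 ≤ t → N t = ∫ s in (0 : ℝ)..t, A s := fun {t} ht => by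
    simp only [hN, max_eq_left ht]
  have hNs : ∀ {a b : ℝ}, 0 ≤ a → 0 ≤ b → ∫ s in a..b, A s = N b - N a := fun {a b} ha hb => by
    rw [hNe ha, hNe hb, intervalIntegral.integral_interval_sub_left (hAi le_rfl hb) (hAi le_rfl ha)]
  set NN : ℝ → ℝ := fun t => ∫ s in (0 : ℝ)..t, N s with hNN
  have hNi : ∀ a b, IntervalIntegrable N volume a b := fun a b => hNc.intervalIntegrable a b
  have hNNs : ∀ a b, ∫ s in a..b, N s = NN b - NN a := fun a b => by
    rw [hNN, intervalIntegral.integral_interval_sub_left (hNi _ _) (hNi _ _)]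
  have p1 : ∀ {t ξ : ℝ}, 0 ≤ t → ξ ∈ Icc (0 : ℝ) 1 →
      L2.prim ξ (x t).vel + L2.prim ξ (x t).pos.dx = N (t + ξ) - N t := fun {t ξ} ht hξ => by
    rw [← map_add, L2.prim_congr hξ (hi t ht).1, intervalIntegral.integral_comp_add_left, add_zero,
      hNs ht (add_nonneg ht hξ.1)]
  have p2 : ∀ {t ξ : ℝ}, 0 ≤ t → ξ ∈ Icc (0 : ℝ) 1 →
      L2.prim ξ (x t).pos.dx - L2.prim ξ (x t).vel = N (t + 2) - N (t + 2 - ξ) :=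
    fun {t ξ} ht hξ => by
    rw [← map_sub, L2.prim_congr hξ (hi t ht).2, intervalIntegral.integral_comp_sub_left, sub_zero,
      hNs (by linarith [hξ.2]) (by linarith)]
  have hl : ∀ {t : ℝ}, 0 ≤ t → (x t).pos.left = (N t - N (t + 2)) / 2 := fun {t} ht => by
    have e := hr t ht
    have q1 := p1 ht (right_mem_Icc.2 zero_le_one)
    have q2 := p2 ht (right_mem_Icc.2 zero_le_one)
    rw [show t + 2 - 1 = t + 1 by ring] at q2
    rw [H1.right_eq] at e
    linarith
  have hA' : DelaySolution c0 c1 A (fun t => (x t).pos.left) := hA.congr fun t ht => by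
    rw [hl ht, hNs ht (by linarith)]
    ring
  have dxe : ∀ {t ξ : ℝ}, 0 ≤ t → ξ ∈ Icc (0 : ℝ) 1 → L2.prim ξ (x t).pos.dx
      = (N (t + ξ) - N (t + 2 - ξ) + N (t + 2) - N t) / 2 := fun {t ξ} ht hξ => by
    linarith [p1 ht hξ, p2 ht hξ]
  have vele : ∀ {t ξ : ℝ}, 0 ≤ t → ξ ∈ Icc (0 : ℝ) 1 → L2.prim ξ (x t).vel
      = (N (t + ξ) + N (t + 2 - ξ) - N (t + 2) - N t) / 2 := fun {t ξ} ht hξ => by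
    linarith [p1 ht hξ, p2 ht hξ]
  -- the four kinds of integrals that occur
  have j1 : ∀ t b : ℝ, ∫ ξ in (0 : ℝ)..b, N (t + ξ) = NN (t + b) - NN t := fun t b => by
    rw [intervalIntegral.integral_comp_add_left, add_zero, hNNs]
  have j2 : ∀ t b : ℝ, ∫ ξ in (0 : ℝ)..b, N (t + 2 - ξ) = NN (t + 2) - NN (t + 2 - b) :=
    fun t b => by rw [intervalIntegral.integral_comp_sub_left, sub_zero, hNNs]
  have j3 : ∀ t b : ℝ, ∫ s in (0 : ℝ)..t, N (s + b) = NN (t + b) - NN b := fun t b => by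
    rw [intervalIntegral.integral_comp_add_right, zero_add, hNNs]
  have j4 : ∀ t b : ℝ, ∫ s in (0 : ℝ)..t, N (s + 2 - b) = NN (t + 2 - b) - NN (2 - b) :=
    fun t b => by simpa only [add_sub_assoc] using j3 t (2 - b)
  have i1 : ∀ t a b : ℝ, IntervalIntegrable (fun ξ => N (t + ξ)) volume a b := fun t a b =>
    (hNc.comp (by fun_prop : Continuous fun ξ => t + ξ)).intervalIntegrable a b
  have i2 : ∀ t a b : ℝ, IntervalIntegrable (fun ξ => N (t + 2 - ξ)) volume a b := fun t a b =>
    (hNc.comp (by fun_prop : Continuous fun ξ => t + 2 - ξ)).intervalIntegrable a b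
  have i3 : ∀ t a b : ℝ, IntervalIntegrable (fun s => N (s + t)) volume a b := fun t a b =>
    (hNc.comp (by fun_prop : Continuous fun s => s + t)).intervalIntegrable a b
  have i4 : ∀ t a b : ℝ, IntervalIntegrable (fun s => N (s + 2 - t)) volume a b := fun t a b =>
    (hNc.comp (by fun_prop : Continuous fun s => s + 2 - t)).intervalIntegrable a b
  have hvc := continuousOn_vel hx
  have hdc := continuousOn_dx hx
  -- integrals over `(0,ξ)`
  have fne : ∀ {t ξ : ℝ}, 0 ≤ t → ξ ∈ Icc (0 : ℝ) 1 → L2.prim ξ (x t).pos.fn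
      = ((NN (t + ξ) - NN t) - (NN (t + 2) - NN (t + 2 - ξ))) / 2 := fun {t ξ} ht hξ => by
    rw [isPrimitive_iff.1 (x t).pos.left_spec ξ hξ, ← j1, ← j2,
      ← intervalIntegral.integral_sub (i1 _ _ _) (i2 _ _ _), ← intervalIntegral.integral_div]
    refine intervalIntegral.integral_congr fun r hr => ?_
    rw [uIcc_of_le hξ.1] at hr
    simp only [hl ht, dxe ht ⟨hr.1, hr.2.trans hξ.2⟩]
    ring
  have velint : ∀ {t ξ : ℝ}, 0 ≤ t → ξ ∈ Icc (0 : ℝ) 1 →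
      ∫ s in (0 : ℝ)..t, L2.prim ξ (x s).vel = ((NN (t + ξ) - NN ξ)
        + (NN (t + 2 - ξ) - NN (2 - ξ)) - (NN (t + 2) - NN 2) - (NN t - NN 0)) / 2 :=
    fun {t ξ} ht hξ => by
      rw [← j3, ← j4, ← j3, ← hNNs, ← intervalIntegral.integral_add (i3 _ _ _) (i4 _ _ _),
        ← intervalIntegral.integral_sub ((i3 _ _ _).add (i4 _ _ _)) (i3 _ _ _),
        ← intervalIntegral.integral_sub (((i3 _ _ _).add (i4 _ _ _)).sub (i3 _ _ _)) (hNi _ _),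
        ← intervalIntegral.integral_div]
      refine intervalIntegral.integral_congr fun s hs => ?_
      rw [uIcc_of_le ht] at hs
      simp only [vele hs.1 hξ]
  have dxint : ∀ {t ξ : ℝ}, 0 ≤ t → ξ ∈ Icc (0 : ℝ) 1 →
      ∫ s in (0 : ℝ)..t, L2.prim ξ (x s).pos.dx = ((NN (t + ξ) - NN ξ)
        - (NN (t + 2 - ξ) - NN (2 - ξ)) + (NN (t + 2) - NN 2) - (NN t - NN 0)) / 2 :=
    fun {t ξ} ht hξ => by
      rw [← j3, ← j4, ← j3, ← hNNs, ← intervalIntegral.integral_sub (i3 _ _ _) (i4 _ _ _),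
        ← intervalIntegral.integral_add ((i3 _ _ _).sub (i4 _ _ _)) (i3 _ _ _),
        ← intervalIntegral.integral_sub (((i3 _ _ _).sub (i4 _ _ _)).add (i3 _ _ _)) (hNi _ _),
        ← intervalIntegral.integral_div]
      refine intervalIntegral.integral_congr fun s hs => ?_
      rw [uIcc_of_le ht] at hs
      simp only [dxe hs.1 hξ]
  have NN0 : NN 0 = 0 := by simp [hNN]
  have N0 : N 0 = 0 := by simp [hN]
  refine ⟨⟨hx, fun t ht => ?_⟩, ?_, hr⟩
  · refine hasDerivWithinAt_of_integral (f := fun s => (x s).pos.fn) hvc (fun t ht => ?_) ht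
    refine L2.ext_of_prim fun ξ hξ => ?_
    rw [map_sub, ← integral_prim ht (hvc.mono Icc_subset_Ici_self), velint ht hξ, fne ht hξ,
      fne le_rfl hξ]
    simp only [zero_add]
    ring
  · refine (waveLeft_iff hx).2 fun t ht => isPrimitive_iff.2 fun ξ hξ => ?_
    rw [intDx, ← integral_prim ht (hdc.mono Icc_subset_Ici_self), dxint ht hξ]
    have e : ∫ r in (0 : ℝ)..ξ, (((N (t + r) + N (t + 2 - r)) - (N (0 + r) + N (0 + 2 - r))) / 2)
        = ((NN (t + ξ) - NN t) + (NN (t + 2) - NN (t + 2 - ξ))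
          - ((NN (0 + ξ) - NN 0) + (NN (0 + 2) - NN (0 + 2 - ξ)))) / 2 := by
      rw [← j1, ← j2, ← j1, ← j2, ← intervalIntegral.integral_add (i1 _ _ _) (i2 _ _ _),
        ← intervalIntegral.integral_add (i1 _ _ _) (i2 _ _ _), ← intervalIntegral.integral_sub
          ((i1 _ _ _).add (i2 _ _ _)) ((i1 _ _ _).add (i2 _ _ _)), ← intervalIntegral.integral_div]
    rw [intervalIntegral.integral_congr (g := fun r =>
      ((N (t + r) + N (t + 2 - r)) - (N (0 + r) + N (0 + 2 - r))) / 2) fun r hr => ?_]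
    · rw [e]
      simp only [zero_add]
      ring
    · rw [uIcc_of_le hξ.1] at hr
      have hr1 : r ∈ Icc (0 : ℝ) 1 := ⟨hr.1, hr.2.trans hξ.2⟩
      have ef := hA'.flux_eq h1 ht
      simp only at ef ⊢
      rw [ef, map_sub, vele ht hr1, vele le_rfl hr1, hl ht, hl le_rfl, ← hNe ht, N0]
      ring

/-- Existence for every initial state: the invariant starts with `y_t + y_x` on `(0,1)` and with the
reflection of `y_x - y_t` on `(1,2)`. -/
lemma exists_isErrorSolution {c0 c1 : ℝ} (h1 : c0 < 1) (x0 : State0) :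
    ∃ x, IsErrorSolution c0 c1 x0 x := by
  set a : L2 := x0.snd + (x0.fst : H1).dx with ha
  set b : L2 := (x0.fst : H1).dx - x0.snd with hb
  have hbm : IntervalIntegrable (fun s => b (1 - s) ^ 2) volume 0 1 := by
    have := (b.intervalIntegrable_sq.comp_sub_left 1).symm
    simpa using this
  have h₀ : LocL2 (fun t => if t < 1 then a t else
      (fun s => if s < 1 then b (1 - s) else (fun _ => 0) (s - 1)) (t - 1)) :=
    .glue zero_le_one (Lp.aestronglyMeasurable a) a.intervalIntegrable_sq <|
      .glue zero_le_one
        ((Lp.stronglyMeasurable b).measurable.comp (measurable_const.sub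
          measurable_id)).aestronglyMeasurable hbm (.of_continuousOn continuousOn_const)
  obtain ⟨A, hA0, hA⟩ := exists_delaySolution_of_initial c0 c1 h₀
  obtain ⟨G, hGc, hG⟩ := exists_continuousOn_comp hA.locL2
    (φ := fun t => ⟨fun ξ => t + ξ, by fun_prop⟩)
    (ContinuousMap.continuous_of_continuous_uncurry _
      (by fun_prop : Continuous fun q : ℝ × ℝ => q.1 + q.2))
    (fun t => measurePreserving_add_left volume t)
    (fun t ht ξ hξ => ⟨by simp only [ContinuousMap.coe_mk]; linarith [hξ.1],
      by simp only [ContinuousMap.coe_mk]; linarith [hξ.2]⟩)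
  obtain ⟨R, hRc, hR⟩ := exists_continuousOn_comp hA.locL2
    (φ := fun t => ⟨fun ξ => t + 2 - ξ, by fun_prop⟩)
    (ContinuousMap.continuous_of_continuous_uncurry _
      (by fun_prop : Continuous fun q : ℝ × ℝ => q.1 + 2 - q.2))
    (fun t => Measure.measurePreserving_sub_left volume (t + 2))
    (fun t ht ξ hξ => ⟨by simp only [ContinuousMap.coe_mk]; linarith [hξ.2],
      by simp only [ContinuousMap.coe_mk]; linarith [hξ.1]⟩)
  simp only [ContinuousMap.coe_mk] at hG hR
  set x : ℝ → State0 := fun t => WithLp.toLp 2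
    (H1R.ofDx ((1 / 2 : ℝ) • (G t + R t)), (1 / 2 : ℝ) • (G t - R t)) with hx
  have hdx : ∀ t, (x t).toState.pos.dx = (1 / 2 : ℝ) • (G t + R t) := fun t => H1R.dx_ofDx _
  have hvel : ∀ t, (x t).toState.vel = (1 / 2 : ℝ) • (G t - R t) := fun t => rfl
  have hxc : ContinuousOn x (Ici 0) :=
    (WithLp.prod_continuous_toLp 2 H1R L2).comp_continuousOn
      ((H1R.ofDx.continuous.comp_continuousOn ((hGc.add hRc).const_smul (1 / 2 : ℝ))).prodMk
        ((hGc.sub hRc).const_smul (1 / 2 : ℝ)))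
  have hd : DampedTrajectory c0 c1 (fun t => (x t).toState) := by
    refine dampedTrajectory_of_invariant h1 (State0.continuous_toState.comp_continuousOn hxc)
      (fun t _ => (x t).fst.2) hA fun t ht => ⟨?_, ?_⟩
    · have e : (x t).toState.vel + (x t).toState.pos.dx = G t := by rw [hdx, hvel]; module
      rw [e]
      exact hG t ht
    · have e : (x t).toState.pos.dx - (x t).toState.vel = R t := by rw [hdx, hvel]; module
      rw [e]
      exact hR t ht
  have hG0 : G 0 = a := Lp.ext (by
    filter_upwards [hG 0 le_rfl, ae_restrict_mem measurableSet_Ioo] with ξ e hξ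
    rw [e, zero_add, hA0 _ (by linarith [hξ.2]), if_pos hξ.2])
  have hR0 : R 0 = b := Lp.ext (by
    filter_upwards [hR 0 le_rfl, ae_restrict_mem measurableSet_Ioo] with ξ e hξ
    rw [e, zero_add, hA0 _ (by linarith [hξ.1]), if_neg (by linarith [hξ.2])]
    beta_reduce
    rw [if_pos (by linarith [hξ.1])]
    congr 1
    ring)
  refine ⟨x, hxc, ?_, hd.traj, hd.left⟩
  refine WithLp.ofLp_injective 2 (Prod.ext (H1R.ext_of_dx ?_) ?_)
  · change (H1R.ofDx ((1 / 2 : ℝ) • (G 0 + R 0)) : H1).dx = (x0.fst : H1).dx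
    rw [H1R.dx_ofDx, hG0, hR0, ha, hb]
    module
  · change (1 / 2 : ℝ) • (G 0 - R 0) = x0.snd
    rw [hG0, hR0, ha, hb]
    module

/-! ### Linearity -/

lemma IsTrajectory.sub {x x' : ℝ → State} (h : IsTrajectory x) (h' : IsTrajectory x') :
    IsTrajectory (fun t => x t - x' t) :=
  ⟨h.cont.sub h'.cont, fun t ht => (h.deriv t ht).sub (h'.deriv t ht)⟩

lemma IsTrajectory.add {x x' : ℝ → State} (h : IsTrajectory x) (h' : IsTrajectory x') :
    IsTrajectory (fun t => x t + x' t) :=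
  ⟨h.cont.add h'.cont, fun t ht => (h.deriv t ht).add (h'.deriv t ht)⟩

lemma H1.left_sub (y y' : H1) : (y - y').left = y.left - y'.left := by
  have := H1.left_add (y - y') y'
  rw [sub_add_cancel] at this
  linarith

lemma H1.right_sub (y y' : H1) : (y - y').right = y.right - y'.right := by
  have := H1.right_add (y - y') y'
  rw [sub_add_cancel] at this
  linarith

lemma intervalIntegrable_inner_dx {x : ℝ → State} (hx : ContinuousOn x (Ici 0)) (ψ : L2) {t : ℝ}
    (ht : 0 ≤ t) : IntervalIntegrable (fun s => (⟪(x s).pos.dx, ψ⟫ : ℝ)) volume 0 t :=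
  (((continuousOn_dx hx).inner continuousOn_const).mono Icc_subset_Ici_self).intervalIntegrable_of_Icc
    ht

lemma WaveLeft.add {x x' : ℝ → State} {P P' : ℝ → ℝ} (hx : ContinuousOn x (Ici 0))
    (hx' : ContinuousOn x' (Ici 0)) (h : WaveLeft x P) (h' : WaveLeft x' P') :
    WaveLeft (fun t => x t + x' t) (fun t => P t + P' t) := fun φ hφ t ht => by
  have e := h φ hφ t ht
  have e' := h' φ hφ t ht
  have i := intervalIntegrable_inner_dx hx φ.dx ht
  have i' := intervalIntegrable_inner_dx hx' φ.dx ht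
  change (⟪(x t).vel + (x' t).vel, φ.fn⟫ : ℝ) - ⟪(x 0).vel + (x' 0).vel, φ.fn⟫
    = -(∫ s in (0 : ℝ)..t, (⟪(x s).pos.dx + (x' s).pos.dx, φ.dx⟫ : ℝ)) - (P t + P' t) * φ.left
  simp only [inner_add_left]
  rw [intervalIntegral.integral_add i i']
  linarith

lemma WaveLeft.sub {x x' : ℝ → State} {P P' : ℝ → ℝ} (hx : ContinuousOn x (Ici 0))
    (hx' : ContinuousOn x' (Ici 0)) (h : WaveLeft x P) (h' : WaveLeft x' P') :
    WaveLeft (fun t => x t - x' t) (fun t => P t - P' t) := fun φ hφ t ht => by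
  have e := h φ hφ t ht
  have e' := h' φ hφ t ht
  have i := intervalIntegrable_inner_dx hx φ.dx ht
  have i' := intervalIntegrable_inner_dx hx' φ.dx ht
  change (⟪(x t).vel - (x' t).vel, φ.fn⟫ : ℝ) - ⟪(x 0).vel - (x' 0).vel, φ.fn⟫
    = -(∫ s in (0 : ℝ)..t, (⟪(x s).pos.dx - (x' s).pos.dx, φ.dx⟫ : ℝ)) - (P t - P' t) * φ.left
  simp only [inner_sub_left]
  rw [intervalIntegral.integral_sub i i']
  linarith

lemma HasRightFlux.integrable {x : ℝ → State} {g : ℝ → ℝ} (h : HasRightFlux x g) {t : ℝ}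
    (ht : 0 ≤ t) : IntervalIntegrable g volume 0 t :=
  (intervalIntegrable_iff_integrableOn_Icc_of_le ht).2
    (h.1.integrableOn_compact_subset Icc_subset_Ici_self isCompact_Icc)

lemma HasRightFlux.add {x x' : ℝ → State} {g g' : ℝ → ℝ} (hx : ContinuousOn x (Ici 0))
    (hx' : ContinuousOn x' (Ici 0)) (h : HasRightFlux x g) (h' : HasRightFlux x' g') :
    HasRightFlux (fun t => x t + x' t) (fun t => g t + g' t) := by
  refine ⟨h.1.add h'.1, fun φ hφ t ht => ?_⟩
  have e := h.2 φ hφ t ht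
  have e' := h'.2 φ hφ t ht
  have i := intervalIntegrable_inner_dx hx φ.dx ht
  have i' := intervalIntegrable_inner_dx hx' φ.dx ht
  change (⟪(x t).vel + (x' t).vel, φ.fn⟫ : ℝ) - ⟪(x 0).vel + (x' 0).vel, φ.fn⟫
    = -(∫ s in (0 : ℝ)..t, (⟪(x s).pos.dx + (x' s).pos.dx, φ.dx⟫ : ℝ))
      + (∫ s in (0 : ℝ)..t, (g s + g' s)) * φ.right
  simp only [inner_add_left]
  rw [intervalIntegral.integral_add i i',
    intervalIntegral.integral_add (h.integrable ht) (h'.integrable ht)]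
  linarith

lemma HasRightFlux.sub {x x' : ℝ → State} {g g' : ℝ → ℝ} (hx : ContinuousOn x (Ici 0))
    (hx' : ContinuousOn x' (Ici 0)) (h : HasRightFlux x g) (h' : HasRightFlux x' g') :
    HasRightFlux (fun t => x t - x' t) (fun t => g t - g' t) := by
  refine ⟨h.1.sub h'.1, fun φ hφ t ht => ?_⟩
  have e := h.2 φ hφ t ht
  have e' := h'.2 φ hφ t ht
  have i := intervalIntegrable_inner_dx hx φ.dx ht
  have i' := intervalIntegrable_inner_dx hx' φ.dx ht
  change (⟪(x t).vel - (x' t).vel, φ.fn⟫ : ℝ) - ⟪(x 0).vel - (x' 0).vel, φ.fn⟫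
    = -(∫ s in (0 : ℝ)..t, (⟪(x s).pos.dx - (x' s).pos.dx, φ.dx⟫ : ℝ))
      + (∫ s in (0 : ℝ)..t, (g s - g' s)) * φ.right
  simp only [inner_sub_left]
  rw [intervalIntegral.integral_sub i i',
    intervalIntegral.integral_sub (h.integrable ht) (h'.integrable ht)]
  linarith

lemma WaveDampedLeft.sub {c0 c1 : ℝ} {x x' : ℝ → State} (hx : ContinuousOn x (Ici 0))
    (hx' : ContinuousOn x' (Ici 0)) (h : WaveDampedLeft c0 c1 x) (h' : WaveDampedLeft c0 c1 x') :
    WaveDampedLeft c0 c1 (fun t => x t - x' t) := fun φ hφ t ht => by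
  have e := WaveLeft.sub hx hx' h h' φ hφ t ht
  have i : ∀ {x : ℝ → State}, ContinuousOn x (Ici 0) →
      IntervalIntegrable (fun s => (x s).pos.left) volume 0 t := fun hx =>
    ((continuousOn_left hx).mono Icc_subset_Ici_self).intervalIntegrable_of_Icc ht
  have hl : ∀ s, (x s - x' s).pos.left = (x s).pos.left - (x' s).pos.left :=
    fun s => H1.left_sub _ _
  rw [e]
  simp only [hl]
  rw [intervalIntegral.integral_sub (i hx) (i hx')]
  ring

lemma DampedTrajectory.sub {c0 c1 : ℝ} {x x' : ℝ → State} (h : DampedTrajectory c0 c1 x)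
    (h' : DampedTrajectory c0 c1 x') : DampedTrajectory c0 c1 (fun t => x t - x' t) where
  traj := h.traj.sub h'.traj
  left := h.left.sub h.traj.cont h'.traj.cont h'.left
  right t ht := by
    change ((x t).pos - (x' t).pos).right = 0
    rw [H1.right_sub, h.right t ht, h'.right t ht, sub_zero]

lemma IsErrorSolution.dampedTrajectory {c0 c1 : ℝ} {x0 : State0} {x : ℝ → State0}
    (h : IsErrorSolution c0 c1 x0 x) : DampedTrajectory c0 c1 (fun t => (x t).toState) :=
  ⟨h.traj, h.wave, fun t _ => (x t).fst.2⟩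

lemma State0.norm_toState (x : State0) : ‖x.toState‖ = ‖x‖ := by
  refine (sq_eq_sq₀ (norm_nonneg x.toState) (norm_nonneg x)).1 ?_
  exact (WithLp.prod_norm_sq_eq_of_L2 x.toState).trans (WithLp.prod_norm_sq_eq_of_L2 x).symm

lemma IsErrorSolution.eqOn {c0 c1 : ℝ} (h0 : 0 < c0) (h1 : c0 < 1) (hc1 : 0 < c1) {x0 : State0}
    {x x' : ℝ → State0} (h : IsErrorSolution c0 c1 x0 x) (h' : IsErrorSolution c0 c1 x0 x') :
    EqOn x' x (Ici 0) := fun t ht => by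
  have hb := (h'.dampedTrajectory.sub h.dampedTrajectory).norm_le h0 h1 hc1 ht
  simp only [h.init, h'.init, sub_self, norm_zero, mul_zero] at hb
  have hz : ‖(x' t - x t).toState‖ ≤ 0 := hb
  rw [State0.norm_toState] at hz
  exact sub_eq_zero.1 (norm_le_zero_iff.1 hz)

/-! ### The estimator -/

/-- The solution `W` of `W_t = -W_x` as a state `(W, W_t)` of the wave equation. -/
noncomputable def transportState (W : ℝ → H1) (t : ℝ) : State := WithLp.toLp 2 (W t, -(W t).dx)

section Transport

variable {W : ℝ → H1}

lemma isTrajectory_transport (hc : ContinuousOn W (Ici 0))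
    (hW : ∀ t, 0 ≤ t → HasDerivWithinAt (fun s => (W s).fn) (-(W t).dx) (Ici 0) t) :
    IsTrajectory (transportState W) :=
  ⟨(WithLp.prod_continuous_toLp 2 H1 L2).comp_continuousOn
    (hc.prodMk (H1.continuous_dx.comp_continuousOn hc).neg), hW⟩

/-- At the left end `W_x = -W_t`. -/
lemma waveLeft_transport (hc : ContinuousOn W (Ici 0))
    (hW : ∀ t, 0 ≤ t → HasDerivWithinAt (fun s => (W s).fn) (-(W t).dx) (Ici 0) t) :
    WaveLeft (transportState W) (fun t => -((W t).left - (W 0).left)) := by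
  have ht := isTrajectory_transport hc hW
  refine (waveLeft_iff ht.cont).2 fun t h0 => ?_
  have e := ht.integral_vel h0
  have e' : intDx (transportState W) t = (W 0).fn - (W t).fn := by
    have hn : ∫ s in (0 : ℝ)..t, (transportState W s).vel
        = -∫ s in (0 : ℝ)..t, (transportState W s).pos.dx := by
      rw [← intervalIntegral.integral_neg]; rfl
    rw [hn] at e
    rw [intDx, ← neg_sub, ← neg_eq_iff_eq_neg]
    exact e
  rw [e', ← H1.left_sub, ← neg_one_mul]
  have hp := (W t - W 0).left_spec.smul (-1)
  have g1 : (-1 : ℝ) • (W t - W 0).dx = (transportState W t).vel - (transportState W 0).vel := by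
    change (-1 : ℝ) • ((W t).dx - (W 0).dx) = -(W t).dx - -(W 0).dx
    module
  have g2 : (-1 : ℝ) • (W t - W 0).fn = (W 0).fn - (W t).fn := by
    change (-1 : ℝ) • ((W t).fn - (W 0).fn) = (W 0).fn - (W t).fn
    module
  rwa [g1, g2] at hp

end Transport

/-- The signal `v + W - w`, whose boundary value at `1` the estimator feeds into `z`. It satisfies
the damped boundary condition at `0`, because `v + W - w = (1 - c₀)(v - w)` there. -/
lemma waveDampedLeft_estimator {q c0 c1 : ℝ} (h1 : c0 < 1) {f : State → ℝ} {d u : ℝ → ℝ}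
    {w v : ℝ → State} {W : ℝ → H1} {z : ℝ → State} (hp : IsPlantSolution q f d u w)
    (he : IsEstimatorSolution q c0 c1 u w v W z) :
    WaveDampedLeft c0 c1 (fun t => v t + transportState W t - w t) := by
  have hX : 1 - c0 ≠ 0 := by linarith
  have hT := isTrajectory_transport he.W_cont he.W_transport
  have hw := waveLeft_transport he.W_cont he.W_transport
  intro φ hφ t ht
  refine (WaveLeft.sub (he.v_traj.cont.add hT.cont) hp.traj.cont
    (WaveLeft.add he.v_traj.cont hT.cont he.v_left hw) hp.left φ hφ t ht).trans
    (congrArg (fun r => -(∫ s in (0 : ℝ)..t,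
      ⟪(v s + transportState W s - w s).pos.dx, φ.dx⟫) - r * φ.left) ?_)
  have i : ∀ {x : ℝ → State}, ContinuousOn x (Ici 0) →
      IntervalIntegrable (fun s => (x s).pos.left) volume 0 t := fun hx =>
    ((continuousOn_left hx).mono Icc_subset_Ici_self).intervalIntegrable_of_Icc ht
  have iv := i he.v_traj.cont
  have iw := i hp.traj.cont
  have hl : ∀ s, 0 ≤ s → (v s + transportState W s - w s).pos.left
      = (1 - c0) * ((v s).pos.left - (w s).pos.left) := fun s hs => by
    change (((v s).pos + W s) - (w s).pos).left = _
    rw [H1.left_sub, H1.left_add, he.W_left s hs]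
    ring
  have hi : ∫ s in (0 : ℝ)..t, (v s + transportState W s - w s).pos.left
      = ∫ s in (0 : ℝ)..t, (1 - c0) * ((v s).pos.left - (w s).pos.left) :=
    intervalIntegral.integral_congr fun s hs => by
      rw [uIcc_of_le ht] at hs
      exact hl s hs.1
  beta_reduce
  rw [hi, hl t ht, hl 0 le_rfl, he.W_left t ht, he.W_left 0 le_rfl,
    intervalIntegral.integral_add (iw.const_mul _) ((iv.sub iw).const_mul _),
    intervalIntegral.integral_const_mul, intervalIntegral.integral_const_mul,
    intervalIntegral.integral_const_mul]
  field_simp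
  ring

/-- The boundary condition of `v` at `1` cancels `u` and `W_x`, so the flux of `v + W - w` at `1`
is `-F`. -/
lemma hasRightFlux_estimator {q c0 c1 : ℝ} {f : State → ℝ} {d u : ℝ → ℝ}
    {w v : ℝ → State} {W : ℝ → H1} {z : ℝ → State} (hp : IsPlantSolution q f d u w)
    (he : IsEstimatorSolution q c0 c1 u w v W z) :
    HasRightFlux (fun t => v t + transportState W t - w t)
      (fun t => -totalDisturbance f d w t) := by
  have hT := isTrajectory_transport he.W_cont he.W_transport
  obtain ⟨r, hr, hv⟩ := he.v_right
  have h := HasRightFlux.sub (he.v_traj.cont.add hT.cont) hp.traj.cont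
    (HasRightFlux.add he.v_traj.cont hT.cont hv hr) hp.right
  have e : (fun t => u t - r t + r t - (u t + totalDisturbance f d w t))
      = fun t => -totalDisturbance f d w t := by ext t; ring
  rwa [e] at h

/-- The estimation error `z_x(1,·) + F` is the boundary flux of the damped trajectory
`z - (v + W - w)`. -/
lemma estimator_flux {q c0 c1 : ℝ} (h0 : 0 < c0) (h1 : c0 < 1) (hc1 : 0 < c1) {f : State → ℝ}
    {d u : ℝ → ℝ} {w v : ℝ → State} {W : ℝ → H1} {z : ℝ → State} (hp : IsPlantSolution q f d u w)
    (he : IsEstimatorSolution q c0 c1 u w v W z) :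
    ∃ g, HasRightFlux z (fun t => g t - totalDisturbance f d w t) ∧
      MemLp g 2 (volume.restrict (Ioi 0)) := by
  have hT := isTrajectory_transport he.W_cont he.W_transport
  have hs := (he.v_traj.add hT).sub hp.traj
  have hd : DampedTrajectory c0 c1 (fun t => z t - (v t + transportState W t - w t)) := by
    refine ⟨he.z_traj.sub hs,
      he.z_left.sub he.z_traj.cont hs.cont (waveDampedLeft_estimator h1 hp he), fun t ht => ?_⟩
    change ((z t).pos - (((v t).pos + W t) - (w t).pos)).right = 0
    rw [H1.right_sub, H1.right_sub, H1.right_add, he.z_right t ht, sub_self]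
  obtain ⟨g, hg, hm⟩ := hd.hasRightFlux h0 h1 hc1
  refine ⟨g, ?_, hm⟩
  have h := HasRightFlux.add hd.traj.cont hs.cont hg (hasRightFlux_estimator hp he)
  simpa only [sub_add_cancel, ← sub_eq_add_neg] using h

end WaveEstimator

theorem mainTheorem5 (c0 c1 : ℝ) (hc0 : c0 ∈ Set.Ioo (0 : ℝ) 1) (hc1 : 0 < c1) :
    (∀ x0 : WaveEstimator.State0, ∃ x : ℝ → WaveEstimator.State0,
      WaveEstimator.IsErrorSolution c0 c1 x0 x ∧
      (∀ x' : ℝ → WaveEstimator.State0, WaveEstimator.IsErrorSolution c0 c1 x0 x' →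
        Set.EqOn x' x (Set.Ici 0)) ∧
      (∃ g : ℝ → ℝ, WaveEstimator.HasRightFlux (fun t => (x t).toState) g) ∧
      (∀ g : ℝ → ℝ, WaveEstimator.HasRightFlux (fun t => (x t).toState) g →
        MeasureTheory.MemLp g 2 (MeasureTheory.volume.restrict (Set.Ioi (0 : ℝ))))) ∧
    (∃ C : ℝ, ∀ (x0 : WaveEstimator.State0) (x : ℝ → WaveEstimator.State0),
      WaveEstimator.IsErrorSolution c0 c1 x0 x → ∀ t : ℝ, 0 ≤ t → ‖x t‖ ≤ C * ‖x0‖) ∧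
    (∀ (q : ℝ) (f : WaveEstimator.State → ℝ) (d u : ℝ → ℝ) (w v : ℝ → WaveEstimator.State)
      (W : ℝ → WaveEstimator.H1) (z : ℝ → WaveEstimator.State),
      Continuous f →
      MeasureTheory.LocallyIntegrableOn d (Set.Ici 0) →
      MeasureTheory.LocallyIntegrableOn u (Set.Ici 0) →
      WaveEstimator.IsPlantSolution q f d u w →
      WaveEstimator.IsEstimatorSolution q c0 c1 u w v W z →
      (∃ g : ℝ → ℝ, WaveEstimator.HasRightFlux z g) ∧
      (∀ g : ℝ → ℝ, WaveEstimator.HasRightFlux z g →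
        MeasureTheory.MemLp
          (fun t => WaveEstimator.totalDisturbance f d w t - (-g t)) 2
          (MeasureTheory.volume.restrict (Set.Ioi (0 : ℝ))))) := by
  obtain ⟨h0, h1⟩ := hc0
  refine ⟨fun x0 => ?_, ⟨√(5 * (1 + c1 / (1 - c0))), fun x0 x hx t ht => ?_⟩,
    fun q f d u w v W z _ _ _ hp he => ?_⟩
  · obtain ⟨x, hx⟩ := WaveEstimator.exists_isErrorSolution h1 x0
    obtain ⟨g, hg, hm⟩ := hx.dampedTrajectory.hasRightFlux h0 h1 hc1
    exact ⟨x, hx, fun x' hx' => hx.eqOn h0 h1 hc1 hx', ⟨g, hg⟩,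
      fun g' hg' => hm.ae_eq (hg.ae_unique hg')⟩
  · have h := hx.dampedTrajectory.norm_le h0 h1 hc1 ht
    rwa [WaveEstimator.State0.norm_toState, WaveEstimator.State0.norm_toState, hx.init] at h
  · obtain ⟨g, hg, hm⟩ := WaveEstimator.estimator_flux h0 h1 hc1 hp he
    refine ⟨⟨_, hg⟩, fun g' hg' => hm.ae_eq ?_⟩
    filter_upwards [hg.ae_unique hg'] with t e
    rw [← e]
    ring
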